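/- A \emph{probability algebra} is a Boolean algebra $A$ with a finitely additive measure $\mu:A\to[0,1]$ with $\mu(1)=1$ such that $d(a,b):=\mu(a\triangle b)$ is a complete metric on $A$ (equivalently: a $\sigma$-complete Boolean algebra with a strictly positive countably additive probability measure); it is \emph{atomless} if it has no atoms. \emph{Restricted formulas} in the continuous language of probability algebras (function symbols $0,1,{}^c,\cap,\cup$, predicate $\mu$, metric $d$) are built from the atomic formulas $\mu(t)$ and $d(s,t)$, with $s,t$ terms, by the unary connectives $0$, $1$, $x/2$, the binary connective $x\mathbin{\dot-}y=\max(x-y,0)$, and the quantifiers $\inf_x$ and $\sup_x$. For restricted formulas $\varphi(\vec x),\psi(\vec x)$ put $$\|\varphi-\psi\|_T:=\sup\{|\varphi(\vec a)^{A}-\psi(\vec a)^{A}| : A\text{ an atomless probability algebra},\ \vec a\in A\}.$$ \textbf{Theorem.} The theory $T$ of atomless probability algebras admits effective quantifier-elimination: there is an algorithm that, given a restricted formula $\varphi(\vec x)$ and a rational $\epsilon>0$, returns a quantifier-free restricted formula $\psi(\vec x)$, with all its variables among the free variables of $\varphi$, such that $\|\varphi-\psi\|_T<\epsilon$. -/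

import Mathlib

universe u

/-! ### Probability algebras -/

/-- A probability algebra, as a (complete) metric structure: a Boolean algebra with a finitely
additive measure `μ` of total mass `1` such that `d a b = μ (a ∆ b)` is a complete metric.
(The metric being separated, `μ` is strictly positive; completeness of the metric amounts to
`σ`-completeness of the algebra together with countable additivity of `μ`.) -/
class ProbabilityAlgebra (A : Type u) extends BooleanAlgebra A, MetricSpace A where
  μ : A → ℝ
  μ_top : μ ⊤ = 1
  μ_sup_of_disjoint : ∀ a b : A, Disjoint a b → μ (a ⊔ b) = μ a + μ b
  dist_eq_μ : ∀ a b : A, dist a b = μ (symmDiff a b)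
  complete : CompleteSpace A

/-- An atomless probability algebra: no element is an atom of the Boolean algebra. -/
class AtomlessProbabilityAlgebra (A : Type u) extends ProbabilityAlgebra A where
  not_isAtom : ∀ a : A, ¬ IsAtom a

namespace ProbabilityAlgebra

variable {A : Type u} [ProbabilityAlgebra A]

theorem μ_eq_dist (a : A) : μ a = dist a ⊥ := by
  rw [dist_eq_μ, symmDiff_bot]

theorem μ_nonneg (a : A) : 0 ≤ μ a := by
  rw [μ_eq_dist]; exact dist_nonneg

theorem μ_le_one (a : A) : μ a ≤ 1 := by
  have h := μ_sup_of_disjoint a aᶜ disjoint_compl_right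
  rw [sup_compl_eq_top, μ_top] at h
  linarith [μ_nonneg aᶜ]

theorem dist_le_one (a b : A) : dist a b ≤ 1 := by
  rw [dist_eq_μ]; exact μ_le_one _

end ProbabilityAlgebra

/-! ### The language of probability algebras -/

namespace PrA

/-- Terms in the function symbols `0, 1, ᶜ, ∩, ∪`, over the variables `x₀, x₁, …`. -/
inductive BTerm : Type
  | var : ℕ → BTerm
  | bot : BTerm
  | top : BTerm
  | compl : BTerm → BTerm
  | inter : BTerm → BTerm → BTerm
  | union : BTerm → BTerm → BTerm

/-- Restricted formulas: atomic formulas `μ(t)` and `d(s, t)`, closed under the connectives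
`0`, `1`, `x / 2` (unary), `x ∸ y` (binary), and under the quantifiers `inf_{xₙ}`, `sup_{xₙ}`. -/
inductive RFormula : Type
  | meas : BTerm → RFormula
  | metric : BTerm → BTerm → RFormula
  | zero : RFormula → RFormula
  | one : RFormula → RFormula
  | half : RFormula → RFormula
  | monus : RFormula → RFormula → RFormula
  | qinf : ℕ → RFormula → RFormula
  | qsup : ℕ → RFormula → RFormula

namespace BTerm

/-- The variables that occur in a term. -/
def vars : BTerm → Finset ℕ
  | var n => {n}
  | bot => ∅
  | top => ∅
  | compl t => t.vars
  | inter s t => s.vars ∪ t.vars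
  | union s t => s.vars ∪ t.vars

/-- The value of a term in a Boolean algebra under an assignment. -/
def eval {A : Type u} [BooleanAlgebra A] (v : ℕ → A) : BTerm → A
  | var n => v n
  | bot => ⊥
  | top => ⊤
  | compl t => (t.eval v)ᶜ
  | inter s t => s.eval v ⊓ t.eval v
  | union s t => s.eval v ⊔ t.eval v

/-- The code number of a term. -/
def toCode : BTerm → ℕ
  | bot => 0
  | top => 1
  | var n => 4 * n + 2
  | compl t => 4 * t.toCode + 3
  | inter s t => 4 * Nat.pair s.toCode t.toCode + 4
  | union s t => 4 * Nat.pair s.toCode t.toCode + 5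

/-- The term with a given code number. -/
def ofCode : ℕ → BTerm
  | 0 => bot
  | 1 => top
  | n + 2 =>
    have h0 : n / 4 < n + 2 := by omega
    have h1 : (n / 4).unpair.1 < n + 2 := lt_of_le_of_lt (Nat.unpair_left_le _) h0
    have h2 : (n / 4).unpair.2 < n + 2 := lt_of_le_of_lt (Nat.unpair_right_le _) h0
    match n % 4 with
    | 0 => var (n / 4)
    | 1 => compl (ofCode (n / 4))
    | 2 => inter (ofCode (n / 4).unpair.1) (ofCode (n / 4).unpair.2)
    | _ => union (ofCode (n / 4).unpair.1) (ofCode (n / 4).unpair.2)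

theorem ofCode_toCode (t : BTerm) : ofCode t.toCode = t := by
  induction t with
  | var n =>
    have e1 : 4 * n % 4 = 0 := by omega
    have e2 : 4 * n / 4 = n := by omega
    rw [toCode, ofCode, e1, e2]; rfl
  | bot => rw [toCode, ofCode]
  | top => rw [toCode, ofCode]
  | compl t ih =>
    have e1 : (4 * t.toCode + 1) % 4 = 1 := by omega
    have e2 : (4 * t.toCode + 1) / 4 = t.toCode := by omega
    rw [toCode, ofCode, e1, e2]; simp [ih]
  | inter s t ihs iht =>
    have e1 : (4 * Nat.pair s.toCode t.toCode + 2) % 4 = 2 := by omega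
    have e2 : (4 * Nat.pair s.toCode t.toCode + 2) / 4 = Nat.pair s.toCode t.toCode := by omega
    rw [toCode, ofCode, e1, e2]; simp [ihs, iht]
  | union s t ihs iht =>
    have e1 : (4 * Nat.pair s.toCode t.toCode + 3) % 4 = 3 := by omega
    have e2 : (4 * Nat.pair s.toCode t.toCode + 3) / 4 = Nat.pair s.toCode t.toCode := by omega
    rw [toCode, ofCode, e1, e2]; simp [ihs, iht]

theorem toCode_ofCode (n : ℕ) : (ofCode n).toCode = n := by
  induction n using Nat.strong_induction_on with
  | _ n ih =>
    match n with
    | 0 => rw [ofCode, toCode]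
    | 1 => rw [ofCode, toCode]
    | n + 2 =>
      have h0 : n / 4 < n + 2 := by omega
      have i0 := ih _ h0
      have i1 := ih _ (lt_of_le_of_lt (Nat.unpair_left_le _) h0)
      have i2 := ih _ (lt_of_le_of_lt (Nat.unpair_right_le _) h0)
      have hn : n % 4 = 0 ∨ n % 4 = 1 ∨ n % 4 = 2 ∨ n % 4 = 3 := by omega
      rw [ofCode]
      rcases hn with h | h | h | h <;> rw [h] <;> simp only [toCode, i0, i1, i2, Nat.pair_unpair] <;>
        omega

/-- The Gödel numbering of terms. -/
instance : Denumerable BTerm :=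
  Denumerable.mk' ⟨toCode, ofCode, ofCode_toCode, toCode_ofCode⟩

end BTerm

namespace RFormula

/-- The free variables of a formula. -/
def freeVars : RFormula → Finset ℕ
  | meas t => t.vars
  | metric s t => s.vars ∪ t.vars
  | zero φ => φ.freeVars
  | one φ => φ.freeVars
  | half φ => φ.freeVars
  | monus φ ψ => φ.freeVars ∪ ψ.freeVars
  | qinf n φ => φ.freeVars.erase n
  | qsup n φ => φ.freeVars.erase n

/-- A formula is quantifier-free if no `inf` or `sup` occurs in it. -/
def QuantifierFree : RFormula → Prop
  | meas _ => True
  | metric _ _ => True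
  | zero φ => φ.QuantifierFree
  | one φ => φ.QuantifierFree
  | half φ => φ.QuantifierFree
  | monus φ ψ => φ.QuantifierFree ∧ ψ.QuantifierFree
  | qinf _ _ => False
  | qsup _ _ => False

/-- The value of a formula in a probability algebra, under an assignment of the variables. -/
noncomputable def eval {A : Type u} [ProbabilityAlgebra A] : RFormula → (ℕ → A) → ℝ
  | meas t, v => ProbabilityAlgebra.μ (t.eval v)
  | metric s t, v => dist (s.eval v) (t.eval v)
  | zero _, _ => 0
  | one _, _ => 1
  | half φ, v => φ.eval v / 2
  | monus φ ψ, v => max (φ.eval v - ψ.eval v) 0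
  | qinf n φ, v => ⨅ a : A, φ.eval (Function.update v n a)
  | qsup n φ, v => ⨆ a : A, φ.eval (Function.update v n a)

/-- Values lie in `[0, 1]`; in particular the infima and suprema above are those of bounded
nonempty sets. -/
theorem eval_mem {A : Type u} [ProbabilityAlgebra A] (φ : RFormula) (v : ℕ → A) :
    φ.eval v ∈ Set.Icc (0 : ℝ) 1 := by
  induction φ generalizing v with
  | meas t => exact ⟨ProbabilityAlgebra.μ_nonneg _, ProbabilityAlgebra.μ_le_one _⟩
  | metric s t => exact ⟨dist_nonneg, ProbabilityAlgebra.dist_le_one _ _⟩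
  | zero φ _ => simp [eval]
  | one φ _ => simp [eval]
  | half φ ih => obtain ⟨h0, h1⟩ := ih v; rw [eval]; constructor <;> linarith
  | monus φ ψ ih1 ih2 =>
    obtain ⟨h0, h1⟩ := ih1 v
    obtain ⟨k0, k1⟩ := ih2 v
    rw [eval]
    exact ⟨le_max_right _ _, max_le (by linarith) zero_le_one⟩
  | qinf n φ ih =>
    rw [eval]
    refine ⟨le_ciInf fun a => (ih _).1, ?_⟩
    exact (ciInf_le ⟨0, by rintro _ ⟨a, rfl⟩; exact (ih _).1⟩ ⊥).trans (ih _).2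
  | qsup n φ ih =>
    rw [eval]
    refine ⟨?_, ciSup_le fun a => (ih _).2⟩
    exact (ih _).1.trans
      (le_ciSup (f := fun a : A => φ.eval (Function.update v n a))
        ⟨1, by rintro _ ⟨a, rfl⟩; exact (ih _).2⟩ ⊥)

/-- The code number of a formula. -/
def toCode : RFormula → ℕ
  | meas t => 8 * Encodable.encode t
  | metric s t => 8 * Nat.pair (Encodable.encode s) (Encodable.encode t) + 1
  | zero φ => 8 * φ.toCode + 2
  | one φ => 8 * φ.toCode + 3
  | half φ => 8 * φ.toCode + 4
  | monus φ ψ => 8 * Nat.pair φ.toCode ψ.toCode + 5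
  | qinf n φ => 8 * Nat.pair n φ.toCode + 6
  | qsup n φ => 8 * Nat.pair n φ.toCode + 7

/-- The formula with a given code number. -/
def ofCode (n : ℕ) : RFormula :=
  if h : n % 8 = 0 then meas (Denumerable.ofNat BTerm (n / 8))
  else
    have h0 : n / 8 < n := by omega
    have h1 : (n / 8).unpair.1 < n := lt_of_le_of_lt (Nat.unpair_left_le _) h0
    have h2 : (n / 8).unpair.2 < n := lt_of_le_of_lt (Nat.unpair_right_le _) h0
    match n % 8 with
    | 1 => metric (Denumerable.ofNat BTerm (n / 8).unpair.1)
        (Denumerable.ofNat BTerm (n / 8).unpair.2)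
    | 2 => zero (ofCode (n / 8))
    | 3 => one (ofCode (n / 8))
    | 4 => half (ofCode (n / 8))
    | 5 => monus (ofCode (n / 8).unpair.1) (ofCode (n / 8).unpair.2)
    | 6 => qinf (n / 8).unpair.1 (ofCode (n / 8).unpair.2)
    | _ => qsup (n / 8).unpair.1 (ofCode (n / 8).unpair.2)

theorem ofCode_toCode (φ : RFormula) : ofCode φ.toCode = φ := by
  have key : ∀ m k : ℕ, k < 8 → (8 * m + k) % 8 = k ∧ (8 * m + k) / 8 = m := by omega
  induction φ with
  | meas t =>
    obtain ⟨e1, e2⟩ := key (Encodable.encode t) 0 (by norm_num)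
    rw [Nat.add_zero] at e1 e2
    rw [toCode, ofCode, dif_pos e1, e2]; simp
  | metric s t =>
    obtain ⟨e1, e2⟩ := key (Nat.pair (Encodable.encode s) (Encodable.encode t)) 1 (by norm_num)
    rw [toCode, ofCode, dif_neg (by omega)]; simp only [e1, e2]; simp
  | zero φ ih =>
    obtain ⟨e1, e2⟩ := key φ.toCode 2 (by norm_num)
    rw [toCode, ofCode, dif_neg (by omega)]; simp only [e1, e2]; simp [ih]
  | one φ ih =>
    obtain ⟨e1, e2⟩ := key φ.toCode 3 (by norm_num)
    rw [toCode, ofCode, dif_neg (by omega)]; simp only [e1, e2]; simp [ih]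
  | half φ ih =>
    obtain ⟨e1, e2⟩ := key φ.toCode 4 (by norm_num)
    rw [toCode, ofCode, dif_neg (by omega)]; simp only [e1, e2]; simp [ih]
  | monus φ ψ ih1 ih2 =>
    obtain ⟨e1, e2⟩ := key (Nat.pair φ.toCode ψ.toCode) 5 (by norm_num)
    rw [toCode, ofCode, dif_neg (by omega)]; simp only [e1, e2]; simp [ih1, ih2]
  | qinf n φ ih =>
    obtain ⟨e1, e2⟩ := key (Nat.pair n φ.toCode) 6 (by norm_num)
    rw [toCode, ofCode, dif_neg (by omega)]; simp only [e1, e2]; simp [ih]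
  | qsup n φ ih =>
    obtain ⟨e1, e2⟩ := key (Nat.pair n φ.toCode) 7 (by norm_num)
    rw [toCode, ofCode, dif_neg (by omega)]; simp only [e1, e2]; simp [ih]

theorem toCode_ofCode (n : ℕ) : (ofCode n).toCode = n := by
  induction n using Nat.strong_induction_on with
  | _ n ih =>
    rw [ofCode]
    split_ifs with h
    · simp only [toCode, Denumerable.encode_ofNat]; omega
    · have h0 : n / 8 < n := by omega
      have i0 := ih _ h0
      have i1 := ih _ (lt_of_le_of_lt (Nat.unpair_left_le _) h0)
      have i2 := ih _ (lt_of_le_of_lt (Nat.unpair_right_le _) h0)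
      have hn : n % 8 = 1 ∨ n % 8 = 2 ∨ n % 8 = 3 ∨ n % 8 = 4 ∨ n % 8 = 5 ∨ n % 8 = 6 ∨
        n % 8 = 7 := by omega
      rcases hn with h | h | h | h | h | h | h <;> rw [h] <;>
        simp only [toCode, i0, i1, i2, Nat.pair_unpair, Denumerable.encode_ofNat] <;> omega

/-- The Gödel numbering of restricted formulas: computability of functions on formulas refers to
this numbering. -/
instance : Denumerable RFormula :=
  Denumerable.mk' ⟨toCode, ofCode, ofCode_toCode, toCode_ofCode⟩

end RFormula

/-- All the numbers `|φ(a) - ψ(a)|`, where `a` is a tuple from an atomless probability algebra. -/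
def gaps (φ ψ : RFormula) : Set ℝ :=
  {r | ∃ (A : Type u) (_ : AtomlessProbabilityAlgebra A) (v : ℕ → A), r = |φ.eval v - ψ.eval v|}

theorem gaps_bddAbove (φ ψ : RFormula) : BddAbove (gaps.{u} φ ψ) := by
  refine ⟨1, ?_⟩
  rintro _ ⟨A, _, v, rfl⟩
  obtain ⟨h0, h1⟩ := φ.eval_mem v
  obtain ⟨k0, k1⟩ := ψ.eval_mem v
  rw [abs_le]; constructor <;> linarith

/-- The distance `‖φ - ψ‖_T` modulo the theory `T` of atomless probability algebras. -/
noncomputable def theoryDist (φ ψ : RFormula) : ℝ := sSup (gaps.{u} φ ψ)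

end PrA

/-!
Why atomless probability algebras have effective quantifier elimination.

*One quantifier.* Let `ψ(x, y)` be quantifier-free. The value depends, given
`y`, only on the fraction of each cell of the partition generated by `y` that `x` takes up, and in
an atomless algebra all fractions occur. Dyadic fractions with denominator `2ᵐ` suffice up to an error
`2⁻ᵐ`, and an `x` with such fractions is a Boolean combination `t(y, r)` of `y` and of `m` coins
`r`: elements that cut every Boolean combination of `y` and of the other coins into halves. So
`inf_x ψ(x, y)` is approximated by the minimum of `ψ(t(y, r), y)` over the finitely many Boolean
combinations `t`. A coin can be removed from a quantifier-free formula: as it is independent of the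
rest, `μ(s(y, r))` is the mean of `μ(s(y, 0))` and `μ(s(y, 1))`, and means can be written with
`1`, `x / 2` and `∸`. This is `PrA.RFormula.elimInf`; suprema are treated as `1 - inf (1 - ·)`.

*Semantics.* That there are enough coins follows from the fact that in an atomless probability
algebra every value between `0` and `μ p` is the measure of a part of `p`
(`AtomlessProbabilityAlgebra.exists_le_μ_eq`). Given `x`, coins can be chosen one after the other so
that each new coin lies inside `x` or covers `x` in every cell of the algebra generated so far
(`PrA.exists_adapted_coin`). Each one then halves the measure of the part on which `x` is not yet
decided, so that `m` coins describe `x` up to `2⁻ᵐ` (`PrA.exists_coinTower`). Conversely, averaging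
computes the value at any actual coins (`PrA.RFormula.eval_averageCoins`).

*Error.* `PrA.RFormula.elim m` eliminates all the quantifiers of `φ` with the same precision `m`.
Each quantifier costs `2⁻ᵐ` times the Lipschitz constant of the original subformula under it, not
of the quantifier-free formula computed from that, so that the total error is at most `c · 2⁻ᵐ` with
`c` depending on `φ` alone; `c = 2 ^ (code of φ)` will do (`PrA.RFormula.abs_eval_sub_eval_elim_le`).
Hence `m` can be computed in advance from `φ` and `ε`.

*Computability.* `elim` is built by structural recursions on terms and formulas and by recursions on
lists. Structural recursion is course-of-values recursion on codes (`PrA.primrec_of_term_rec`,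
`PrA.primrec_of_formula_rec`), so that `elim` is primitive recursive.
-/

/-! ### Measure in probability algebras -/

namespace ProbabilityAlgebra

open Filter Topology

variable {A : Type u} [ProbabilityAlgebra A]

theorem μ_bot : μ (⊥ : A) = 0 := by rw [μ_eq_dist, dist_self]

theorem μ_inf_add_inf_compl (a b : A) : μ (a ⊓ b) + μ (a ⊓ bᶜ) = μ a := by
  rw [← μ_sup_of_disjoint, ← inf_sup_left, sup_compl_eq_top, inf_top_eq]
  exact disjoint_compl_right.mono inf_le_right inf_le_right

theorem μ_inf_compl_of_le {a b : A} (h : a ≤ b) : μ (b ⊓ aᶜ) = μ b - μ a := by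
  have := μ_inf_add_inf_compl b a
  rw [inf_eq_right.2 h] at this
  linarith

theorem μ_mono {a b : A} (h : a ≤ b) : μ a ≤ μ b := by
  linarith [μ_inf_compl_of_le h, μ_nonneg (b ⊓ aᶜ)]

theorem μ_pos {a : A} (h : a ≠ ⊥) : 0 < μ a := by
  rw [μ_eq_dist]
  exact dist_pos.2 h

theorem dist_of_le {a b : A} (h : a ≤ b) : dist a b = μ b - μ a := by
  rw [dist_eq_μ, symmDiff_of_le h, sdiff_eq, μ_inf_compl_of_le h]

theorem abs_μ_sub_le (a b : A) : |μ a - μ b| ≤ dist a b := by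
  rw [μ_eq_dist, μ_eq_dist]
  exact abs_dist_sub_le a b ⊥

theorem dist_inf_le (a b c : A) : dist (a ⊓ c) (b ⊓ c) ≤ dist a b := by
  rw [dist_eq_μ, dist_eq_μ, ← inf_symmDiff_distrib_right]
  exact μ_mono inf_le_left

theorem continuous_μ : Continuous (μ : A → ℝ) := by
  have : (μ : A → ℝ) = fun a => dist a ⊥ := funext μ_eq_dist
  rw [this]
  fun_prop

theorem continuous_inf_const (c : A) : Continuous fun a : A => a ⊓ c :=
  (LipschitzWith.of_dist_le_mul (K := 1) fun a b => by simpa using dist_inf_le a b c).continuous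

theorem le_of_tendsto_of_le {f : ℕ → A} {s p : A} (hf : Tendsto f atTop (𝓝 s))
    (hp : ∀ k, f k ≤ p) : s ≤ p := by
  have h := ((continuous_inf_const p).tendsto s).comp hf
  have e : (fun a : A => a ⊓ p) ∘ f = f := funext fun k => inf_eq_left.2 (hp k)
  rw [e] at h
  exact inf_eq_left.1 (tendsto_nhds_unique h hf)

theorem le_of_tendsto_of_monotone {f : ℕ → A} {s : A} (hm : Monotone f)
    (hf : Tendsto f atTop (𝓝 s)) (k : ℕ) : f k ≤ s := by
  have h := ((continuous_inf_const (f k)).tendsto s).comp hf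
  have e : ∀ᶠ l in atTop, ((fun a : A => a ⊓ f k) ∘ f) l = f k := by
    filter_upwards [eventually_ge_atTop k] with l hl
    exact inf_eq_right.2 (hm hl)
  have := tendsto_nhds_unique (h.congr' e) tendsto_const_nhds
  exact inf_eq_right.1 this

/-- Since `d (a, b) = μ b - μ a` for `a ≤ b`, the bounded increasing sequence of the measures makes
the sequence Cauchy. -/
theorem exists_tendsto_of_monotone {f : ℕ → A} (hm : Monotone f) :
    ∃ s, Tendsto f atTop (𝓝 s) := by
  have : CompleteSpace A := complete
  have hmono : Monotone fun k => μ (f k) := fun i j h => μ_mono (hm h)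
  have hc : CauchySeq fun k => μ (f k) :=
    (tendsto_atTop_ciSup hmono ⟨1, by rintro _ ⟨k, rfl⟩; exact μ_le_one _⟩).cauchySeq
  refine cauchySeq_tendsto_of_complete ?_
  rw [Metric.cauchySeq_iff] at hc ⊢
  intro ε hε
  obtain ⟨N, hN⟩ := hc ε hε
  refine ⟨N, fun i hi j hj => ?_⟩
  have h := hN i hi j hj
  rw [Real.dist_eq] at h
  rcases le_total i j with hij | hij
  · rw [dist_of_le (hm hij)]
    linarith [neg_abs_le (μ (f i) - μ (f j))]
  · rw [dist_comm, dist_of_le (hm hij)]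
    linarith [le_abs_self (μ (f i) - μ (f j))]

end ProbabilityAlgebra

namespace AtomlessProbabilityAlgebra

open Filter Topology ProbabilityAlgebra

variable {A : Type u} [AtomlessProbabilityAlgebra A]

theorem exists_le_μ_le_half {p : A} (hp : p ≠ ⊥) : ∃ b ≤ p, b ≠ ⊥ ∧ μ b ≤ μ p / 2 := by
  have h := not_isAtom p
  simp only [IsAtom, not_and, not_forall] at h
  obtain ⟨b, hb, hb0⟩ := h hp
  have hs := μ_inf_compl_of_le hb.le
  rcases le_total (μ b) (μ p / 2) with h1 | h1
  · exact ⟨b, hb.le, hb0, h1⟩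
  · refine ⟨p ⊓ bᶜ, inf_le_left, fun h0 => ?_, by linarith⟩
    exact hb.not_ge (by rwa [← sdiff_eq, sdiff_eq_bot_iff] at h0)

theorem exists_le_μ_lt {p : A} (hp : p ≠ ⊥) {δ : ℝ} (hδ : 0 < δ) :
    ∃ b ≤ p, b ≠ ⊥ ∧ μ b < δ := by
  have key : ∀ k : ℕ, ∃ b ≤ p, b ≠ ⊥ ∧ μ b ≤ (1 / 2) ^ k := by
    intro k
    induction k with
    | zero => exact ⟨p, le_rfl, hp, by simpa using μ_le_one p⟩
    | succ k ih =>
      obtain ⟨b, hb, hb0, hbk⟩ := ih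
      obtain ⟨c, hc, hc0, hck⟩ := exists_le_μ_le_half hb0
      exact ⟨c, hc.trans hb, hc0, by rw [pow_succ]; linarith⟩
  obtain ⟨k, hk⟩ := exists_pow_lt_of_lt_one hδ (by norm_num : (1 / 2 : ℝ) < 1)
  obtain ⟨b, hb, hb0, hbk⟩ := key k
  exact ⟨b, hb, hb0, hbk.trans_lt hk⟩

/-- In an atomless probability algebra every value below `μ p` is the measure of a part of `p`.
An increasing sequence of parts of measure at most `c` is built greedily, each step gaining at
least half of what can be gained; its limit has measure `c`, as otherwise a small part of the
complement could still be added. -/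
theorem exists_le_μ_eq {p : A} {c : ℝ} (h0 : 0 ≤ c) (hc : c ≤ μ p) : ∃ r ≤ p, μ r = c := by
  let S : Set A := {r | r ≤ p ∧ μ r ≤ c}
  have step : ∀ r : S, ∃ r' : S, r.1 ≤ r'.1 ∧
      ∀ s ∈ S, r.1 ≤ s → μ s - μ r.1 ≤ 2 * (μ r'.1 - μ r.1) := by
    rintro ⟨r, hr⟩
    let V : Set ℝ := μ '' {s | s ∈ S ∧ r ≤ s}
    have hb : BddAbove V := ⟨1, by rintro _ ⟨s, -, rfl⟩; exact μ_le_one s⟩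
    have hrV : μ r ∈ V := ⟨r, ⟨hr, le_rfl⟩, rfl⟩
    by_cases hV : sSup V ≤ μ r
    · refine ⟨⟨r, hr⟩, le_rfl, fun s hs hrs => ?_⟩
      linarith [le_csSup hb (⟨s, ⟨hs, hrs⟩, rfl⟩ : μ s ∈ V)]
    · obtain ⟨_, ⟨r', hr', rfl⟩, hlt⟩ :=
        exists_lt_of_lt_csSup (b := (sSup V + μ r) / 2) ⟨_, hrV⟩ (by linarith)
      refine ⟨⟨r', hr'.1⟩, hr'.2, fun s hs hrs => ?_⟩
      have := le_csSup hb (⟨s, ⟨hs, hrs⟩, rfl⟩ : μ s ∈ V)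
      simp only
      linarith
  choose next hnext hgain using step
  let f : ℕ → S := fun k => next^[k] ⟨⊥, bot_le, by rwa [μ_bot]⟩
  have hf : ∀ k, f (k + 1) = next (f k) := fun k => Function.iterate_succ_apply' _ _ _
  have hm : Monotone fun k => (f k).1 := monotone_nat_of_le_succ fun k => by
    rw [hf]; exact hnext _
  obtain ⟨r, hr⟩ := exists_tendsto_of_monotone hm
  have hrp : r ≤ p := le_of_tendsto_of_le hr fun k => (f k).2.1
  have hμ : Tendsto (fun k => μ (f k).1) atTop (𝓝 (μ r)) := (continuous_μ.tendsto r).comp hr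
  have hrc : μ r ≤ c := le_of_tendsto' hμ fun k => (f k).2.2
  refine ⟨r, hrp, hrc.antisymm (not_lt.1 fun hlt => ?_)⟩
  have hne : p ⊓ rᶜ ≠ ⊥ := fun h => by
    have := μ_inf_compl_of_le hrp
    rw [h, μ_bot] at this
    linarith
  obtain ⟨b, hb, hb0, hbc⟩ := exists_le_μ_lt hne (sub_pos.2 hlt)
  have hμb : μ (r ⊔ b) = μ r + μ b :=
    μ_sup_of_disjoint r b (disjoint_compl_right.mono_right (hb.trans inf_le_right))
  have hS : r ⊔ b ∈ S := ⟨sup_le hrp (hb.trans inf_le_left), by linarith⟩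
  have hk : ∀ k, μ (r ⊔ b) - μ (f k).1 ≤ 2 * (μ (f (k + 1)).1 - μ (f k).1) := fun k => by
    rw [hf]
    exact hgain _ _ hS ((le_of_tendsto_of_monotone hm hr k).trans le_sup_left)
  have := le_of_tendsto_of_tendsto' (tendsto_const_nhds.sub hμ)
    (((hμ.comp (tendsto_add_atTop_nat 1)).sub hμ).const_mul 2) hk
  linarith [μ_pos hb0]

/-- The values between `μ a` and `μ p` are attained between `a` and `p`. -/
theorem exists_between_μ_eq {a p : A} (h : a ≤ p) {c : ℝ} (h0 : μ a ≤ c) (hc : c ≤ μ p) :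
    ∃ r, a ≤ r ∧ r ≤ p ∧ μ r = c := by
  obtain ⟨b, hb, hbc⟩ := exists_le_μ_eq (p := p ⊓ aᶜ) (c := c - μ a) (by linarith)
    (by rw [μ_inf_compl_of_le h]; linarith)
  refine ⟨a ⊔ b, le_sup_left, sup_le h (hb.trans inf_le_left), ?_⟩
  rw [μ_sup_of_disjoint a b (disjoint_compl_right.mono_right (hb.trans inf_le_right)), hbc]
  ring

end AtomlessProbabilityAlgebra

/-! ### Terms and the finite subalgebras they generate -/

namespace PrA

open ProbabilityAlgebra AtomlessProbabilityAlgebra Function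

namespace BTerm

/-- `s.subst n t` is the term `s` with the term `t` in place of the variable `n`. -/
def subst : BTerm → ℕ → BTerm → BTerm
  | var k, n, t => if k = n then t else var k
  | bot, _, _ => bot
  | top, _, _ => top
  | compl s, n, t => compl (s.subst n t)
  | inter s₁ s₂, n, t => inter (s₁.subst n t) (s₂.subst n t)
  | union s₁ s₂, n, t => union (s₁.subst n t) (s₂.subst n t)

/-- The symmetric difference of two terms. -/
def symm (s t : BTerm) : BTerm := union (inter s (compl t)) (inter t (compl s))

/-- The term that is `s` on `x` and `t` off `x`. -/
def cond (x s t : BTerm) : BTerm := union (inter x s) (inter (compl x) t)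

/-- The variables of a term, as a list. -/
def varList : BTerm → List ℕ
  | var n => [n]
  | bot => []
  | top => []
  | compl t => t.varList
  | inter s t => s.varList ++ t.varList
  | union s t => s.varList ++ t.varList

/-- Terms for all the Boolean combinations of the variables in a list, by Shannon expansion. -/
def shannon : List ℕ → List BTerm
  | [] => [bot, top]
  | n :: l => (shannon l).flatMap fun s => (shannon l).map fun t => cond (var n) s t

theorem mem_varList {t : BTerm} {k : ℕ} : k ∈ t.varList ↔ k ∈ t.vars := by
  induction t <;> simp_all [varList, vars]

theorem vars_symm (s t : BTerm) : (s.symm t).vars = s.vars ∪ t.vars := by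
  ext k
  simp only [symm, vars, Finset.mem_union]
  tauto

theorem vars_subst {n k : ℕ} {s t : BTerm} (h : k ∈ (s.subst n t).vars) :
    (k ∈ s.vars ∧ k ≠ n) ∨ k ∈ t.vars := by
  induction s with
  | var i =>
    rw [subst] at h
    split_ifs at h with hi
    · exact Or.inr h
    · rw [vars, Finset.mem_singleton] at h
      subst h
      exact Or.inl ⟨by simp [vars], hi⟩
  | bot => simp [subst, vars] at h
  | top => simp [subst, vars] at h
  | compl s ih => exact ih h
  | inter s₁ s₂ ih₁ ih₂ | union s₁ s₂ ih₁ ih₂ =>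
    simp only [subst, vars, Finset.mem_union] at h ⊢
    rcases h with h | h
    · have := ih₁ h
      tauto
    · have := ih₂ h
      tauto

theorem vars_of_mem_shannon {l : List ℕ} {t : BTerm} (h : t ∈ shannon l) :
    ∀ k ∈ t.vars, k ∈ l := by
  induction l generalizing t with
  | nil =>
    simp only [shannon, List.mem_cons, List.not_mem_nil, or_false] at h
    rcases h with rfl | rfl <;> simp [vars]
  | cons n l ih =>
    simp only [shannon, List.mem_flatMap, List.mem_map] at h
    obtain ⟨s, hs, t, ht, rfl⟩ := h
    intro k hk
    simp only [cond, vars, Finset.mem_union, Finset.mem_singleton] at hk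
    rcases hk with (rfl | hk) | (rfl | hk)
    · exact List.mem_cons_self
    · exact List.mem_cons_of_mem _ (ih hs k hk)
    · exact List.mem_cons_self
    · exact List.mem_cons_of_mem _ (ih ht k hk)

section Boolean

variable {A : Type u} [BooleanAlgebra A]

theorem eval_subst (n : ℕ) (t s : BTerm) (v : ℕ → A) :
    (s.subst n t).eval v = s.eval (update v n (t.eval v)) := by
  induction s with
  | var i =>
    by_cases hi : i = n
    · subst hi
      simp [subst, eval]
    · simp [subst, eval, hi]
  | bot | top => rfl
  | compl s ih => simp only [subst, eval, ih]
  | inter s₁ s₂ ih₁ ih₂ | union s₁ s₂ ih₁ ih₂ => simp only [subst, eval, ih₁, ih₂]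

theorem eval_symm (s t : BTerm) (v : ℕ → A) :
    (s.symm t).eval v = symmDiff (s.eval v) (t.eval v) := by
  simp only [symm, eval, symmDiff, sdiff_eq]

/-- Terms act locally: where two assignments agree, so do the values of a term. -/
theorem inf_eval_congr {e : A} {t : BTerm} {v w : ℕ → A}
    (h : ∀ k ∈ t.vars, e ⊓ v k = e ⊓ w k) : e ⊓ t.eval v = e ⊓ t.eval w := by
  induction t with
  | var n => exact h n (by simp [vars])
  | bot | top => rfl
  | compl t ih =>
    have key : ∀ a : A, e ⊓ aᶜ = e ⊓ (e ⊓ a)ᶜ := fun a => by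
      rw [compl_inf, inf_sup_left, inf_compl_eq_bot, bot_sup_eq]
    rw [eval, eval, key, key (t.eval w), ih h]
  | inter s t ih₁ ih₂ =>
    simp only [vars, Finset.mem_union] at h
    simp only [eval]
    rw [inf_inf_distrib_left, ih₁ fun k hk => h k (Or.inl hk), ih₂ fun k hk => h k (Or.inr hk),
      ← inf_inf_distrib_left]
  | union s t ih₁ ih₂ =>
    simp only [vars, Finset.mem_union] at h
    simp only [eval]
    rw [inf_sup_left, ih₁ fun k hk => h k (Or.inl hk), ih₂ fun k hk => h k (Or.inr hk),
      ← inf_sup_left]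

theorem eval_congr {t : BTerm} {v w : ℕ → A} (h : ∀ k ∈ t.vars, v k = w k) :
    t.eval v = t.eval w := by
  have := inf_eval_congr (e := ⊤) (t := t) (v := v) (w := w) fun k hk => by rw [h k hk]
  simpa using this

/-- A term is a contraction in each variable, for the algebra-valued distance `∆`. -/
theorem symmDiff_eval_update_le (t : BTerm) (v : ℕ → A) (n : ℕ) (a b : A) :
    symmDiff (t.eval (update v n a)) (t.eval (update v n b)) ≤ symmDiff a b := by
  have h : (symmDiff a b)ᶜ ⊓ t.eval (update v n a) = (symmDiff a b)ᶜ ⊓ t.eval (update v n b) := by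
    refine inf_eval_congr fun k _ => ?_
    by_cases hk : k = n
    · subst hk
      rw [update_self, update_self, ← symmDiff_eq_bot, ← inf_symmDiff_distrib_left,
        compl_inf_eq_bot]
    · rw [update_of_ne hk, update_of_ne hk]
  rw [← symmDiff_eq_bot, ← inf_symmDiff_distrib_left] at h
  rw [← sdiff_eq_bot_iff, sdiff_eq, inf_comm]
  exact h

/-- The finite subalgebra of values of Boolean combinations of the variables in `l`. -/
def gen (v : ℕ → A) (l : List ℕ) : Set A := {a | ∃ t ∈ shannon l, t.eval v = a}

theorem mem_gen_nil {v : ℕ → A} {a : A} : a ∈ gen v [] ↔ a = ⊥ ∨ a = ⊤ := by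
  simp [gen, shannon, eval, eq_comm]

theorem mem_gen_cons {v : ℕ → A} {n : ℕ} {l : List ℕ} {a : A} :
    a ∈ gen v (n :: l) ↔ ∃ b ∈ gen v l, ∃ c ∈ gen v l, a = (v n ⊓ b) ⊔ ((v n)ᶜ ⊓ c) := by
  constructor
  · rintro ⟨t, ht, rfl⟩
    simp only [shannon, List.mem_flatMap, List.mem_map] at ht
    obtain ⟨s, hs, t, ht, rfl⟩ := ht
    exact ⟨_, ⟨s, hs, rfl⟩, _, ⟨t, ht, rfl⟩, rfl⟩
  · rintro ⟨_, ⟨s, hs, rfl⟩, _, ⟨t, ht, rfl⟩, rfl⟩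
    refine ⟨cond (var n) s t, ?_, rfl⟩
    simp only [shannon, List.mem_flatMap, List.mem_map]
    exact ⟨s, hs, t, ht, rfl⟩

theorem gen_congr {v w : ℕ → A} {l : List ℕ} (h : ∀ k ∈ l, v k = w k) : gen v l = gen w l := by
  ext a
  refine exists_congr fun t => and_congr_right fun ht => ?_
  rw [eval_congr fun k hk => h k (vars_of_mem_shannon ht k hk)]

theorem gen_subset_cons {v : ℕ → A} {n : ℕ} {l : List ℕ} : gen v l ⊆ gen v (n :: l) :=
  fun a ha => mem_gen_cons.2 ⟨a, ha, a, ha, by rw [← inf_sup_right, sup_compl_eq_top, top_inf_eq]⟩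

theorem bot_mem_gen (v : ℕ → A) (l : List ℕ) : ⊥ ∈ gen v l := by
  induction l with
  | nil => exact mem_gen_nil.2 (Or.inl rfl)
  | cons n l ih => exact gen_subset_cons ih

theorem top_mem_gen (v : ℕ → A) (l : List ℕ) : ⊤ ∈ gen v l := by
  induction l with
  | nil => exact mem_gen_nil.2 (Or.inr rfl)
  | cons n l ih => exact gen_subset_cons ih

theorem var_mem_gen (v : ℕ → A) {l : List ℕ} {n : ℕ} (h : n ∈ l) : v n ∈ gen v l := by
  induction l with
  | nil => simp at h
  | cons k l ih =>
    rcases List.mem_cons.1 h with rfl | h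
    · exact mem_gen_cons.2 ⟨⊤, top_mem_gen v l, ⊥, bot_mem_gen v l, by simp⟩
    · exact gen_subset_cons (ih h)

theorem cond_inf (y b c : A) : ((y ⊓ b) ⊔ (yᶜ ⊓ c)) ⊓ y = b ⊓ y := by
  rw [inf_sup_right, inf_right_comm, inf_idem, inf_right_comm, compl_inf_eq_bot, bot_inf_eq,
    sup_bot_eq, inf_comm]

theorem cond_inf_compl (y b c : A) : ((y ⊓ b) ⊔ (yᶜ ⊓ c)) ⊓ yᶜ = c ⊓ yᶜ := by
  rw [inf_sup_right, inf_right_comm, inf_compl_eq_bot, bot_inf_eq, inf_right_comm, inf_idem,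
    bot_sup_eq, inf_comm]

theorem compl_cond (y b c : A) : ((y ⊓ b) ⊔ (yᶜ ⊓ c))ᶜ = (y ⊓ bᶜ) ⊔ (yᶜ ⊓ cᶜ) := by
  have h : IsCompl ((y ⊓ b) ⊔ (yᶜ ⊓ c)) ((y ⊓ bᶜ) ⊔ (yᶜ ⊓ cᶜ)) := by
    refine IsCompl.of_eq ?_ ?_
    · rw [inf_sup_left, ← inf_assoc, ← inf_assoc, cond_inf, cond_inf_compl,
        inf_right_comm, inf_compl_eq_bot, bot_inf_eq, inf_right_comm, inf_compl_eq_bot, bot_inf_eq,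
        sup_bot_eq]
    · rw [sup_sup_sup_comm, ← inf_sup_left, ← inf_sup_left, sup_compl_eq_top, sup_compl_eq_top,
        inf_top_eq, inf_top_eq, sup_compl_eq_top]
  exact h.compl_eq

theorem compl_mem_gen {v : ℕ → A} {l : List ℕ} {a : A} (ha : a ∈ gen v l) : aᶜ ∈ gen v l := by
  induction l generalizing a with
  | nil =>
    rcases mem_gen_nil.1 ha with rfl | rfl <;> simp [mem_gen_nil]
  | cons n l ih =>
    obtain ⟨b, hb, c, hc, rfl⟩ := mem_gen_cons.1 ha
    exact mem_gen_cons.2 ⟨_, ih hb, _, ih hc, compl_cond _ _ _⟩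

theorem sup_mem_gen {v : ℕ → A} {l : List ℕ} {a b : A} (ha : a ∈ gen v l) (hb : b ∈ gen v l) :
    a ⊔ b ∈ gen v l := by
  induction l generalizing a b with
  | nil =>
    rcases mem_gen_nil.1 ha with rfl | rfl <;> rcases mem_gen_nil.1 hb with rfl | rfl <;>
      simp [mem_gen_nil]
  | cons n l ih =>
    obtain ⟨a₁, ha₁, a₂, ha₂, rfl⟩ := mem_gen_cons.1 ha
    obtain ⟨b₁, hb₁, b₂, hb₂, rfl⟩ := mem_gen_cons.1 hb
    refine mem_gen_cons.2 ⟨_, ih ha₁ hb₁, _, ih ha₂ hb₂, ?_⟩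
    rw [sup_sup_sup_comm, ← inf_sup_left, ← inf_sup_left]

theorem inf_mem_gen {v : ℕ → A} {l : List ℕ} {a b : A} (ha : a ∈ gen v l) (hb : b ∈ gen v l) :
    a ⊓ b ∈ gen v l := by
  have := compl_mem_gen (sup_mem_gen (compl_mem_gen ha) (compl_mem_gen hb))
  rwa [compl_sup, compl_compl, compl_compl] at this

theorem eval_mem_gen (v : ℕ → A) {l : List ℕ} {t : BTerm} (h : ∀ k ∈ t.vars, k ∈ l) :
    t.eval v ∈ gen v l := by
  induction t with
  | var n => exact var_mem_gen v (h n (by simp [vars]))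
  | bot => exact bot_mem_gen v l
  | top => exact top_mem_gen v l
  | compl t ih => exact compl_mem_gen (ih h)
  | inter s t ih₁ ih₂ =>
    simp only [vars, Finset.mem_union] at h
    exact inf_mem_gen (ih₁ fun k hk => h k (Or.inl hk)) (ih₂ fun k hk => h k (Or.inr hk))
  | union s t ih₁ ih₂ =>
    simp only [vars, Finset.mem_union] at h
    exact sup_mem_gen (ih₁ fun k hk => h k (Or.inl hk)) (ih₂ fun k hk => h k (Or.inr hk))

end Boolean

end BTerm

open BTerm

/-! ### Coins -/

section Coins

variable {A : Type u}

/-- The element `r` is a fair coin over the variables in `l`: it cuts every Boolean combination of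
them into halves. -/
def IsCoin [ProbabilityAlgebra A] (v : ℕ → A) (l : List ℕ) (r : A) : Prop :=
  ∀ z ∈ gen v l, μ (z ⊓ r) = μ z / 2

/-- Relative to a part `p`, there is a coin `r` over the variables in `l` that is adapted to `x`:
in each cell of the partition generated by `l`, it lies inside `x` (when the cell is below `q`) or
covers `x` (when the cell is disjoint from `q`). -/
theorem exists_adapted_coin_le [AtomlessProbabilityAlgebra A] (v : ℕ → A) (l : List ℕ) (p x : A) :
    ∃ r ≤ p, ∃ q ∈ gen v l, (∀ z ∈ gen v l, μ (z ⊓ r) = μ (z ⊓ p) / 2) ∧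
      r ⊓ q ≤ x ∧ p ⊓ x ⊓ qᶜ ≤ r := by
  induction l generalizing p with
  | nil =>
    have hz : ∀ r ≤ p, μ r = μ p / 2 → ∀ z ∈ gen v [], μ (z ⊓ r) = μ (z ⊓ p) / 2 := by
      rintro r - hr z hz
      rcases mem_gen_nil.1 hz with rfl | rfl
      · simp [μ_bot]
      · simpa using hr
    have hp := μ_nonneg p
    -- there is one cell, `p` itself: the coin goes inside or around the part of `x` in it,
    -- according to which of them is larger
    rcases le_total (μ p / 2) (μ (p ⊓ x)) with h | h
    · obtain ⟨r, hr, hμ⟩ := exists_le_μ_eq (by linarith) h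
      exact ⟨r, hr.trans inf_le_left, ⊤, top_mem_gen v _, hz r (hr.trans inf_le_left) hμ,
        inf_le_left.trans (hr.trans inf_le_right), by simp⟩
    · obtain ⟨r, hr, hrp, hμ⟩ := exists_between_μ_eq (a := p ⊓ x) (p := p) inf_le_left h
        (by linarith)
      exact ⟨r, hrp, ⊥, bot_mem_gen v _, hz r hrp hμ, by simp, inf_le_left.trans hr⟩
  | cons n l ih =>
    -- glue coins for the two sides of the partition by `v n`
    set y := v n with hy
    obtain ⟨r₁, hr₁, q₁, hq₁, hz₁, hle₁, hge₁⟩ := ih (p ⊓ y)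
    obtain ⟨r₂, hr₂, q₂, hq₂, hz₂, hle₂, hge₂⟩ := ih (p ⊓ yᶜ)
    have e₁ : (r₁ ⊔ r₂) ⊓ y = r₁ := by
      rw [inf_sup_right, inf_eq_left.2 (hr₁.trans inf_le_right),
        (disjoint_compl_left.mono_left (hr₂.trans inf_le_right)).eq_bot, sup_bot_eq]
    have e₂ : (r₁ ⊔ r₂) ⊓ yᶜ = r₂ := by
      rw [inf_sup_right, inf_eq_left.2 (hr₂.trans inf_le_right),
        (disjoint_compl_right.mono_left (hr₁.trans inf_le_right)).eq_bot, bot_sup_eq]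
    refine ⟨r₁ ⊔ r₂, sup_le (hr₁.trans inf_le_left) (hr₂.trans inf_le_left), _,
      mem_gen_cons.2 ⟨q₁, hq₁, q₂, hq₂, rfl⟩, ?_, ?_, ?_⟩
    · intro z hz
      obtain ⟨b, hb, c, hc, rfl⟩ := mem_gen_cons.1 hz
      rw [← hy]
      have f₁ : ∀ s, ((y ⊓ b) ⊔ (yᶜ ⊓ c)) ⊓ s ⊓ y = b ⊓ (s ⊓ y) := fun s => by
        rw [inf_right_comm, cond_inf, inf_assoc, inf_comm y]
      have f₂ : ∀ s, ((y ⊓ b) ⊔ (yᶜ ⊓ c)) ⊓ s ⊓ yᶜ = c ⊓ (s ⊓ yᶜ) := fun s => by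
        rw [inf_right_comm, cond_inf_compl, inf_assoc, inf_comm yᶜ]
      rw [← μ_inf_add_inf_compl _ y, ← μ_inf_add_inf_compl (_ ⊓ p) y, f₁, f₂, f₁, f₂, e₁, e₂,
        hz₁ b hb, hz₂ c hc]
      ring
    · rw [← hy, inf_sup_left, ← inf_assoc, ← inf_assoc, e₁, e₂]
      exact sup_le hle₁ hle₂
    · rw [← hy, compl_cond, inf_sup_left]
      refine sup_le_sup (le_trans (le_of_eq ?_) hge₁) (le_trans (le_of_eq ?_) hge₂)
      · rw [← inf_assoc, inf_right_comm p x y]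
      · rw [← inf_assoc, inf_right_comm p x yᶜ]

theorem exists_adapted_coin [AtomlessProbabilityAlgebra A] (v : ℕ → A) (l : List ℕ) (x : A) :
    ∃ r, IsCoin v l r ∧ ∃ q ∈ gen v l, r ⊓ q ≤ x ∧ x ⊓ qᶜ ≤ r := by
  obtain ⟨r, -, q, hq, hz, h₁, h₂⟩ := exists_adapted_coin_le v l ⊤ x
  refine ⟨r, fun z hzl => ?_, q, hq, h₁, ?_⟩
  · rw [hz z hzl, inf_top_eq]
  · rwa [top_inf_eq] at h₂

/-- The list `ys` of variables together with the `k` variables `N, …, N + k - 1`. -/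
def coinVars (N : ℕ) (ys : List ℕ) : ℕ → List ℕ
  | 0 => ys
  | k + 1 => (N + k) :: coinVars N ys k

theorem mem_coinVars {N k i : ℕ} {ys : List ℕ} :
    i ∈ coinVars N ys k ↔ i ∈ ys ∨ N ≤ i ∧ i < N + k := by
  induction k with
  | zero => exact (or_iff_left (by omega)).symm
  | succ k ih =>
    simp only [coinVars, List.mem_cons, ih]
    constructor
    · rintro (h | h | h)
      · exact Or.inr (by omega)
      · exact Or.inl h
      · exact Or.inr (by omega)
    · rintro (h | h)
      · exact Or.inr (Or.inl h)
      · by_cases hi : i = N + k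
        · exact Or.inl hi
        · exact Or.inr (Or.inr (by omega))

/-- The assignment `w` arises from `v` by assigning to the variables `N, …, N + k - 1` coins, each
of them fair over the variables in `ys` and the coins before it. -/
inductive CoinTower [ProbabilityAlgebra A] (N : ℕ) (ys : List ℕ) (v : ℕ → A) :
    ℕ → (ℕ → A) → Prop
  | zero : CoinTower N ys v 0 v
  | succ {k : ℕ} {w : ℕ → A} {r : A} (h : CoinTower N ys v k w)
      (hr : IsCoin w (coinVars N ys k) r) : CoinTower N ys v (k + 1) (update w (N + k) r)

theorem CoinTower.eq_of_lt [ProbabilityAlgebra A] {N k : ℕ} {ys : List ℕ} {v w : ℕ → A}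
    (h : CoinTower N ys v k w) {i : ℕ} (hi : i < N) : w i = v i := by
  induction h with
  | zero => rfl
  | succ _ _ ih => rw [update_of_ne (by omega), ih]

/-- Any element lies between two Boolean combinations of `ys` and of `k` suitable coins, whose
measures differ by at most `2⁻ᵏ`: an adapted coin decides half of every undecided cell. -/
theorem exists_coinTower [AtomlessProbabilityAlgebra A] (N : ℕ) {ys : List ℕ}
    (hN : ∀ i ∈ ys, i < N) (v : ℕ → A) (x : A) (k : ℕ) :
    ∃ w, CoinTower N ys v k w ∧ ∃ a ∈ gen w (coinVars N ys k), ∃ b ∈ gen w (coinVars N ys k),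
      a ≤ x ∧ x ≤ b ∧ μ b - μ a ≤ (1 / 2) ^ k := by
  induction k with
  | zero =>
    exact ⟨v, .zero, ⊥, bot_mem_gen _ _, ⊤, top_mem_gen _ _, bot_le, le_top, by
      simp [μ_top, μ_bot]⟩
  | succ k ih =>
    obtain ⟨w, hw, a, ha, b, hb, hax, hxb, hμ⟩ := ih
    obtain ⟨r, hr, q, hq, hrq, hxq⟩ := exists_adapted_coin w (coinVars N ys k) x
    have hsub : gen w (coinVars N ys k) ⊆ gen (update w (N + k) r) (coinVars N ys (k + 1)) := by
      have e : gen w (coinVars N ys k) = gen (update w (N + k) r) (coinVars N ys k) := by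
        refine gen_congr fun i hi => (update_of_ne ?_ _ _).symm
        rcases mem_coinVars.1 hi with hi | hi
        · exact ((hN i hi).trans_le (Nat.le_add_right N k)).ne
        · omega
      rw [e]
      exact gen_subset_cons
    have hrm : r ∈ gen (update w (N + k) r) (coinVars N ys (k + 1)) := by
      have := var_mem_gen (update w (N + k) r) (l := coinVars N ys (k + 1)) (n := N + k)
        List.mem_cons_self
      rwa [update_self] at this
    have hd : b ⊓ aᶜ ∈ gen w (coinVars N ys k) := inf_mem_gen hb (compl_mem_gen ha)
    -- on the undecided part `b ⊓ aᶜ`, the coin belongs to `x` inside `q`, and the complement of the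
    -- coin is disjoint from `x` outside `q`
    have hdq := inf_mem_gen hd hq
    have hdq' := inf_mem_gen hd (compl_mem_gen hq)
    refine ⟨_, hw.succ hr, a ⊔ (b ⊓ aᶜ ⊓ q ⊓ r), sup_mem_gen (hsub ha)
      (inf_mem_gen (hsub hdq) hrm), b ⊓ (b ⊓ aᶜ ⊓ qᶜ ⊓ rᶜ)ᶜ, inf_mem_gen (hsub hb)
      (compl_mem_gen (inf_mem_gen (hsub hdq') (compl_mem_gen hrm))), ?_, ?_, ?_⟩
    · refine sup_le hax (le_trans ?_ hrq)
      exact le_inf inf_le_right (inf_le_left.trans inf_le_right)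
    · refine le_inf hxb (le_compl_iff_disjoint_right.2 (disjoint_iff_inf_le.2 ?_))
      calc x ⊓ (b ⊓ aᶜ ⊓ qᶜ ⊓ rᶜ) ≤ (x ⊓ qᶜ) ⊓ rᶜ := by
            exact le_inf (le_inf inf_le_left (inf_le_right.trans (inf_le_left.trans inf_le_right)))
              (inf_le_right.trans inf_le_right)
        _ ≤ r ⊓ rᶜ := inf_le_inf_right _ hxq
        _ ≤ ⊥ := inf_compl_eq_bot.le
    · have h₁ : μ (a ⊔ (b ⊓ aᶜ ⊓ q ⊓ r)) = μ a + μ (b ⊓ aᶜ ⊓ q) / 2 := by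
        rw [μ_sup_of_disjoint, hr _ hdq]
        refine disjoint_compl_right.mono_right ?_
        exact inf_le_left.trans (inf_le_left.trans inf_le_right)
      have h₂ : μ (b ⊓ (b ⊓ aᶜ ⊓ qᶜ ⊓ rᶜ)ᶜ) = μ b - μ (b ⊓ aᶜ ⊓ qᶜ) / 2 := by
        rw [μ_inf_compl_of_le (inf_le_left.trans (inf_le_left.trans inf_le_left))]
        have := μ_inf_add_inf_compl (b ⊓ aᶜ ⊓ qᶜ) r
        rw [hr _ hdq'] at this
        linarith
      have h₃ := μ_inf_add_inf_compl (b ⊓ aᶜ) q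
      rw [μ_inf_compl_of_le (hax.trans hxb)] at h₃
      rw [h₁, h₂, pow_succ]
      linarith

end Coins
end PrA

/-! ### Elimination of quantifiers -/

namespace PrA

open ProbabilityAlgebra AtomlessProbabilityAlgebra Function BTerm

namespace RFormula

/-- `1 ∸ φ`. -/
def compl (φ : RFormula) : RFormula := monus (meas top) φ

/-- The sum of two formulas, truncated at `1`. -/
def plus (φ ψ : RFormula) : RFormula := compl (monus (compl φ) ψ)

/-- The minimum of two formulas. -/
def min (φ ψ : RFormula) : RFormula := monus φ (monus φ ψ)

/-- The minimum of a list of formulas, and of `1`. -/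
def listMin (l : List RFormula) : RFormula := l.foldr min (meas top)

/-- The variables occurring in a formula, as a list; those bound by quantifiers are not removed. -/
def varList : RFormula → List ℕ
  | meas t => t.varList
  | metric s t => s.varList ++ t.varList
  | zero φ => φ.varList
  | one φ => φ.varList
  | half φ => φ.varList
  | monus φ ψ => φ.varList ++ ψ.varList
  | qinf _ φ => φ.varList
  | qsup _ φ => φ.varList

/-- Replaces every atomic formula `μ(t)` of a quantifier-free formula by `f t`; here `d(s, t)` is
read as `μ(s ∆ t)`, the constants as `μ(0)` and `μ(1)`. The value on quantifiers is irrelevant. -/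
def mapMeas (f : BTerm → RFormula) : RFormula → RFormula
  | meas t => f t
  | metric s t => f (s.symm t)
  | zero _ => f bot
  | one _ => f top
  | half φ => half (φ.mapMeas f)
  | monus φ ψ => monus (φ.mapMeas f) (ψ.mapMeas f)
  | qinf _ _ => f bot
  | qsup _ _ => f bot

/-- Substitution of the term `t` for the variable `n` in a quantifier-free formula. -/
def subst (φ : RFormula) (n : ℕ) (t : BTerm) : RFormula :=
  φ.mapMeas fun s => meas (s.subst n t)

/-- Eliminates the variable `n` from a quantifier-free formula under the assumption that it stands
for a fair coin: `μ(t)` becomes the mean of its values at `n = 0` and `n = 1`. -/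
def average (n : ℕ) (φ : RFormula) : RFormula :=
  φ.mapMeas fun s => plus (half (meas (s.subst n bot))) (half (meas (s.subst n top)))

/-- Eliminates the coins `N, …, N + m - 1`, the last one first. -/
def averageCoins (N m : ℕ) (φ : RFormula) : RFormula :=
  (List.range m).foldr (fun k ψ => average (N + k) ψ) φ

/-- An approximation of `inf_n φ`, for quantifier-free `φ`: the minimum of the values of `φ` at all
Boolean combinations of its other variables and of `m` coins. The coins are named by variables
that do not occur in `φ`. -/
def elimInf (m n : ℕ) (φ : RFormula) : RFormula :=
  listMin ((shannon (coinVars (φ.varList.sum + n + 1) (φ.varList.filter (· ≠ n)) m)).map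
    fun t => averageCoins (φ.varList.sum + n + 1) m (φ.subst n t))

/-- Quantifier elimination with precision parameter `m`. -/
def elim (m : ℕ) : RFormula → RFormula
  | meas t => meas t
  | metric s t => metric s t
  | zero φ => zero (φ.elim m)
  | one φ => one (φ.elim m)
  | half φ => half (φ.elim m)
  | monus φ ψ => monus (φ.elim m) (ψ.elim m)
  | qinf n φ => elimInf m n (φ.elim m)
  | qsup n φ => compl (elimInf m n (compl (φ.elim m)))

/-! ### The result is quantifier-free -/

theorem QuantifierFree.mapMeas {f : BTerm → RFormula} (hf : ∀ t, (f t).QuantifierFree)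
    (φ : RFormula) : (φ.mapMeas f).QuantifierFree := by
  induction φ with
  | half φ ih => exact ih
  | monus φ ψ ih₁ ih₂ => exact ⟨ih₁, ih₂⟩
  | _ => exact hf _

theorem QuantifierFree.subst (φ : RFormula) (n : ℕ) (t : BTerm) : (φ.subst n t).QuantifierFree :=
  .mapMeas (f := fun s => meas (s.subst n t)) (fun _ => trivial) φ

theorem QuantifierFree.average (n : ℕ) (φ : RFormula) : (φ.average n).QuantifierFree := by
  refine .mapMeas (fun s => ?_) φ
  exact ⟨trivial, ⟨trivial, trivial⟩, trivial⟩

theorem QuantifierFree.averageCoins (N m : ℕ) {φ : RFormula} (h : φ.QuantifierFree) :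
    (φ.averageCoins N m).QuantifierFree := by
  unfold RFormula.averageCoins
  cases List.range m with
  | nil => exact h
  | cons k l => exact .average _ _

theorem QuantifierFree.listMin {l : List RFormula} (h : ∀ φ ∈ l, φ.QuantifierFree) :
    (RFormula.listMin l).QuantifierFree := by
  induction l with
  | nil => trivial
  | cons φ l ih =>
    have h₁ := h φ List.mem_cons_self
    exact ⟨h₁, h₁, ih fun ψ hψ => h ψ (List.mem_cons_of_mem _ hψ)⟩

theorem QuantifierFree.elimInf (m n : ℕ) (φ : RFormula) : (φ.elimInf m n).QuantifierFree := by
  refine .listMin fun ψ hψ => ?_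
  obtain ⟨t, -, rfl⟩ := List.mem_map.1 hψ
  exact .averageCoins _ _ (.subst _ _ _)

theorem quantifierFree_elim (m : ℕ) (φ : RFormula) : (φ.elim m).QuantifierFree := by
  induction φ with
  | meas | metric => trivial
  | zero φ ih | one φ ih | half φ ih => exact ih
  | monus φ ψ ih₁ ih₂ => exact ⟨ih₁, ih₂⟩
  | qinf n φ ih => exact .elimInf _ _ _
  | qsup n φ ih => exact ⟨trivial, .elimInf _ _ _⟩

/-! ### The variables of the result -/

theorem mem_varList {φ : RFormula} (h : φ.QuantifierFree) {k : ℕ} :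
    k ∈ φ.varList ↔ k ∈ φ.freeVars := by
  induction φ with
  | meas t => exact BTerm.mem_varList
  | metric s t => simp [varList, freeVars, BTerm.mem_varList]
  | zero φ ih | one φ ih | half φ ih => exact ih h
  | monus φ ψ ih₁ ih₂ => simp [varList, freeVars, ih₁ h.1, ih₂ h.2]
  | qinf | qsup => exact h.elim

theorem freeVars_compl (φ : RFormula) : φ.compl.freeVars = φ.freeVars := by
  simp [compl, freeVars, vars]

theorem freeVars_mapMeas {f : BTerm → RFormula} {s : Set ℕ} {φ : RFormula}
    (hf : ∀ t : BTerm, t.vars ⊆ φ.freeVars → ∀ k ∈ (f t).freeVars, k ∈ s) :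
    ∀ k ∈ (φ.mapMeas f).freeVars, k ∈ s := by
  induction φ with
  | meas t => exact hf t subset_rfl
  | metric t₁ t₂ => exact hf _ (vars_symm t₁ t₂).subset
  | zero | qinf | qsup => exact hf bot (Finset.empty_subset _)
  | one => exact hf top (Finset.empty_subset _)
  | half φ ih => exact ih hf
  | monus φ ψ ih₁ ih₂ =>
    intro k hk
    rcases Finset.mem_union.1 hk with hk | hk
    · exact ih₁ (fun t ht => hf t (ht.trans Finset.subset_union_left)) k hk
    · exact ih₂ (fun t ht => hf t (ht.trans Finset.subset_union_right)) k hk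

theorem freeVars_subst {φ : RFormula} {n k : ℕ} {t : BTerm} (hk : k ∈ (φ.subst n t).freeVars) :
    (k ∈ φ.freeVars ∧ k ≠ n) ∨ k ∈ t.vars := by
  refine freeVars_mapMeas (s := {k | (k ∈ φ.freeVars ∧ k ≠ n) ∨ k ∈ t.vars})
    (fun s hs i hi => ?_) k hk
  rcases vars_subst hi with h | h
  · exact Or.inl ⟨hs h.1, h.2⟩
  · exact Or.inr h

theorem freeVars_average {φ : RFormula} {n k : ℕ} (hk : k ∈ (φ.average n).freeVars) :
    k ∈ φ.freeVars ∧ k ≠ n := by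
  refine freeVars_mapMeas (s := {k | k ∈ φ.freeVars ∧ k ≠ n}) (fun s hs i hi => ?_) k hk
  have : i ∈ (s.subst n bot).vars ∨ i ∈ (s.subst n top).vars := by
    simpa [plus, compl, freeVars, vars] using hi
  rcases this with h | h <;> rcases vars_subst h with h | h
  · exact ⟨hs h.1, h.2⟩
  · simp [vars] at h
  · exact ⟨hs h.1, h.2⟩
  · simp [vars] at h

theorem averageCoins_succ (N m : ℕ) (φ : RFormula) :
    φ.averageCoins N (m + 1) = (φ.average (N + m)).averageCoins N m := by
  simp [averageCoins, List.range_succ]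

theorem freeVars_averageCoins {φ : RFormula} {N m k : ℕ}
    (hk : k ∈ (φ.averageCoins N m).freeVars) : k ∈ φ.freeVars ∧ ¬ (N ≤ k ∧ k < N + m) := by
  induction m generalizing φ with
  | zero => exact ⟨hk, by omega⟩
  | succ m ih =>
    rw [averageCoins_succ] at hk
    obtain ⟨h₁, h₂⟩ := ih hk
    obtain ⟨h₃, h₄⟩ := freeVars_average h₁
    exact ⟨h₃, by omega⟩

theorem freeVars_listMin {l : List RFormula} {k : ℕ} (hk : k ∈ (listMin l).freeVars) :
    ∃ φ ∈ l, k ∈ φ.freeVars := by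
  induction l with
  | nil => simp [listMin, freeVars, vars] at hk
  | cons φ l ih =>
    have : k ∈ φ.freeVars ∨ k ∈ (listMin l).freeVars := by
      simpa [listMin, min, freeVars] using hk
    rcases this with h | h
    · exact ⟨φ, List.mem_cons_self, h⟩
    · obtain ⟨ψ, hψ, hk⟩ := ih h
      exact ⟨ψ, List.mem_cons_of_mem _ hψ, hk⟩

theorem freeVars_elimInf {φ : RFormula} (h : φ.QuantifierFree) (m n : ℕ) :
    (φ.elimInf m n).freeVars ⊆ φ.freeVars.erase n := by
  intro k hk
  obtain ⟨ψ, hψ, hk⟩ := freeVars_listMin hk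
  obtain ⟨t, ht, rfl⟩ := List.mem_map.1 hψ
  obtain ⟨h₁, h₂⟩ := freeVars_averageCoins hk
  rw [Finset.mem_erase]
  rcases freeVars_subst h₁ with h₁ | h₁
  · exact h₁.symm
  · rcases mem_coinVars.1 (vars_of_mem_shannon ht k h₁) with h₃ | h₃
    · rw [List.mem_filter, mem_varList h] at h₃
      exact ⟨by simpa using h₃.2, h₃.1⟩
    · exact absurd h₃ h₂

theorem freeVars_elim (m : ℕ) (φ : RFormula) : (φ.elim m).freeVars ⊆ φ.freeVars := by
  induction φ with
  | meas | metric => exact subset_rfl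
  | zero φ ih | one φ ih | half φ ih => exact ih
  | monus φ ψ ih₁ ih₂ => exact Finset.union_subset_union ih₁ ih₂
  | qinf n φ ih =>
    exact (freeVars_elimInf (quantifierFree_elim m φ) m n).trans (Finset.erase_subset_erase n ih)
  | qsup n φ ih =>
    rw [elim, freeVars_compl]
    have hq : (φ.elim m).compl.QuantifierFree := ⟨trivial, quantifierFree_elim m φ⟩
    refine (freeVars_elimInf hq m n).trans ?_
    rw [freeVars_compl]
    exact Finset.erase_subset_erase n ih

/-! ### The value of the result -/

section Eval

variable {A : Type u}

section Basic

variable [ProbabilityAlgebra A]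

theorem eval_nonneg (φ : RFormula) (v : ℕ → A) : 0 ≤ φ.eval v := (φ.eval_mem v).1

theorem eval_le_one (φ : RFormula) (v : ℕ → A) : φ.eval v ≤ 1 := (φ.eval_mem v).2

theorem eval_compl (φ : RFormula) (v : ℕ → A) : φ.compl.eval v = 1 - φ.eval v := by
  have := φ.eval_le_one v
  rw [compl, eval, eval, BTerm.eval, μ_top, max_eq_left (by linarith)]

theorem eval_plus {φ ψ : RFormula} {v : ℕ → A} (h : φ.eval v + ψ.eval v ≤ 1) :
    (φ.plus ψ).eval v = φ.eval v + ψ.eval v := by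
  rw [plus, eval_compl, eval, eval_compl, max_eq_left (by linarith)]
  ring

theorem eval_min (φ ψ : RFormula) (v : ℕ → A) :
    (φ.min ψ).eval v = Min.min (φ.eval v) (ψ.eval v) := by
  have := ψ.eval_nonneg v
  rw [min, eval, eval]
  rcases le_total (φ.eval v) (ψ.eval v) with h | h
  · rw [max_eq_right (a := φ.eval v - ψ.eval v) (by linarith), min_eq_left h, sub_zero,
      max_eq_left (φ.eval_nonneg v)]
  · rw [max_eq_left (a := φ.eval v - ψ.eval v) (by linarith), min_eq_right h, sub_sub_cancel,
      max_eq_left this]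

theorem eval_listMin_le {l : List RFormula} {φ : RFormula} (h : φ ∈ l) (v : ℕ → A) :
    (listMin l).eval v ≤ φ.eval v := by
  induction l with
  | nil => simp at h
  | cons ψ l ih =>
    rw [listMin, List.foldr_cons, eval_min, ← listMin]
    rcases List.mem_cons.1 h with rfl | h
    · exact min_le_left _ _
    · exact (min_le_right _ _).trans (ih h)

theorem le_eval_listMin {l : List RFormula} {v : ℕ → A} {c : ℝ} (hc : c ≤ 1)
    (h : ∀ φ ∈ l, c ≤ φ.eval v) : c ≤ (listMin l).eval v := by
  induction l with
  | nil => rwa [listMin, List.foldr_nil, eval, BTerm.eval, μ_top]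
  | cons ψ l ih =>
    rw [listMin, List.foldr_cons, eval_min, ← listMin]
    exact le_min (h _ List.mem_cons_self) (ih fun φ hφ => h φ (List.mem_cons_of_mem _ hφ))

theorem eval_congr {φ : RFormula} {v w : ℕ → A} (h : ∀ k ∈ φ.freeVars, v k = w k) :
    φ.eval v = φ.eval w := by
  have key : ∀ (φ : RFormula) (v w : ℕ → A) (n : ℕ), (∀ k ∈ φ.freeVars.erase n, v k = w k) →
      ∀ a, ∀ k ∈ φ.freeVars, update v n a k = update w n a k := fun φ v w n h a k hk => by
    by_cases hkn : k = n
    · subst hkn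
      rw [update_self, update_self]
    · rw [update_of_ne hkn, update_of_ne hkn, h k (Finset.mem_erase.2 ⟨hkn, hk⟩)]
  induction φ generalizing v w with
  | meas t => rw [eval, eval, BTerm.eval_congr h]
  | metric s t =>
    simp only [freeVars, Finset.mem_union] at h
    rw [eval, eval, BTerm.eval_congr fun k hk => h k (Or.inl hk),
      BTerm.eval_congr fun k hk => h k (Or.inr hk)]
  | zero | one => rfl
  | half φ ih => rw [eval, eval, ih h]
  | monus φ ψ ih₁ ih₂ =>
    simp only [freeVars, Finset.mem_union] at h
    rw [eval, eval, ih₁ fun k hk => h k (Or.inl hk), ih₂ fun k hk => h k (Or.inr hk)]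
  | qinf n φ ih =>
    rw [eval, eval]
    exact iInf_congr fun a => ih (key φ v w n h a)
  | qsup n φ ih =>
    rw [eval, eval]
    exact iSup_congr fun a => ih (key φ v w n h a)

theorem eval_mapMeas {f : BTerm → RFormula} {φ : RFormula} {v w : ℕ → A} (hφ : φ.QuantifierFree)
    (hf : ∀ t : BTerm, t.vars ⊆ φ.freeVars → (f t).eval v = μ (t.eval w)) :
    (φ.mapMeas f).eval v = φ.eval w := by
  induction φ with
  | meas t => exact hf t subset_rfl
  | metric s t =>
    rw [mapMeas, hf _ (vars_symm s t).subset, eval_symm, eval, dist_eq_μ]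
  | zero φ => rw [mapMeas, hf bot (Finset.empty_subset _), BTerm.eval, μ_bot, eval]
  | one φ => rw [mapMeas, hf top (Finset.empty_subset _), BTerm.eval, μ_top, eval]
  | half φ ih => rw [mapMeas, eval, eval, ih hφ hf]
  | monus φ ψ ih₁ ih₂ =>
    rw [mapMeas, eval, eval, ih₁ hφ.1 fun t ht => hf t (ht.trans Finset.subset_union_left),
      ih₂ hφ.2 fun t ht => hf t (ht.trans Finset.subset_union_right)]
  | qinf | qsup => exact hφ.elim

theorem eval_subst {φ : RFormula} (hφ : φ.QuantifierFree) (n : ℕ) (t : BTerm) (v : ℕ → A) :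
    (φ.subst n t).eval v = φ.eval (update v n (t.eval v)) :=
  eval_mapMeas hφ fun s _ => by rw [eval, BTerm.eval_subst]

/-- Averaging over `n` computes the value at a coin over the other variables. -/
theorem eval_average {φ : RFormula} (hφ : φ.QuantifierFree) {n : ℕ} {l : List ℕ}
    (hl : ∀ k ∈ φ.freeVars, k ∈ n :: l) {v : ℕ → A} {r : A} (hr : IsCoin v l r) :
    (φ.average n).eval v = φ.eval (update v n r) := by
  refine eval_mapMeas hφ fun s hs => ?_
  have hmem : ∀ c : BTerm, c.vars = ∅ → (s.subst n c).eval v ∈ gen v l := fun c hc => by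
    refine eval_mem_gen v fun k hk => ?_
    rcases vars_subst hk with h | h
    · exact (List.mem_cons.1 (hl k (hs h.1))).resolve_left h.2
    · simp [hc] at h
  have h₀ := hr _ (hmem bot rfl)
  have h₁ := hr _ (hmem top rfl)
  have h₂ := μ_inf_add_inf_compl ((s.subst n bot).eval v) r
  have h₃ := μ_inf_add_inf_compl (s.eval (update v n r)) r
  have e₁ : s.eval (update v n r) ⊓ r = (s.subst n top).eval v ⊓ r := by
    rw [BTerm.eval_subst, inf_comm, inf_comm _ r]
    refine inf_eval_congr fun k _ => ?_
    by_cases hk : k = n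
    · subst hk
      simp [BTerm.eval]
    · rw [update_of_ne hk, update_of_ne hk]
  have e₂ : s.eval (update v n r) ⊓ rᶜ = (s.subst n bot).eval v ⊓ rᶜ := by
    rw [BTerm.eval_subst, inf_comm, inf_comm _ rᶜ]
    refine inf_eval_congr fun k _ => ?_
    by_cases hk : k = n
    · subst hk
      simp [BTerm.eval]
    · rw [update_of_ne hk, update_of_ne hk]
  have l₀ := μ_le_one ((s.subst n bot).eval v)
  have l₁ := μ_le_one ((s.subst n top).eval v)
  rw [eval_plus (by simp only [eval]; linarith)]
  simp only [eval]
  rw [e₁, e₂] at h₃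
  linarith

theorem eval_averageCoins {φ : RFormula} (hφ : φ.QuantifierFree) {N m : ℕ} {ys : List ℕ}
    (hl : ∀ k ∈ φ.freeVars, k ∈ coinVars N ys m) {v w : ℕ → A} (hw : CoinTower N ys v m w) :
    (φ.averageCoins N m).eval v = φ.eval w := by
  induction hw generalizing φ with
  | zero => rfl
  | succ hw hr ih =>
    rw [averageCoins_succ, ih (.average _ _), eval_average hφ hl hr]
    intro k hk
    obtain ⟨h₁, h₂⟩ := freeVars_average hk
    exact (List.mem_cons.1 (hl k h₁)).resolve_left h₂

theorem abs_max_sub_max_le {a b c d x y : ℝ} (h₁ : |a - c| ≤ x) (h₂ : |b - d| ≤ y) :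
    |max (a - b) 0 - max (c - d) 0| ≤ x + y := by
  refine (abs_max_sub_max_le_abs _ _ _).trans ?_
  rw [show a - b - (c - d) = (a - c) - (b - d) by ring]
  exact (abs_sub _ _).trans (add_le_add h₁ h₂)

theorem bddBelow_range_eval (φ : RFormula) (v : ℕ → A) (n : ℕ) :
    BddBelow (Set.range fun a : A => φ.eval (update v n a)) :=
  ⟨0, by rintro _ ⟨a, rfl⟩; exact eval_nonneg _ _⟩

theorem eval_qsup (φ : RFormula) (v : ℕ → A) (n : ℕ) :
    (qsup n φ).eval v = 1 - (qinf n φ.compl).eval v := by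
  have : Nonempty A := ⟨⊥⟩
  have hb : BddAbove (Set.range fun a : A => φ.eval (update v n a)) :=
    ⟨1, by rintro _ ⟨a, rfl⟩; exact eval_le_one _ _⟩
  rw [eval, eval]
  simp only [eval_compl]
  refine le_antisymm (ciSup_le fun a => ?_) ?_
  · have := ciInf_le (f := fun a : A => 1 - φ.eval (update v n a))
      ⟨0, by rintro _ ⟨a, rfl⟩; exact sub_nonneg.2 (eval_le_one _ _)⟩ a
    linarith
  · rw [sub_le_comm]
    exact le_ciInf fun a => sub_le_sub_left (le_ciSup hb a) 1

theorem abs_iInf_sub_iInf_le {ι : Type*} [Nonempty ι] {f g : ι → ℝ} {c : ℝ}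
    (hf : BddBelow (Set.range f)) (hg : BddBelow (Set.range g)) (h : ∀ i, |f i - g i| ≤ c) :
    |(⨅ i, f i) - ⨅ i, g i| ≤ c := by
  rw [abs_sub_le_iff]
  constructor
  · rw [sub_le_comm]
    refine le_ciInf fun i => ?_
    linarith [ciInf_le hf i, (abs_sub_le_iff.1 (h i)).1]
  · rw [sub_le_comm]
    refine le_ciInf fun i => ?_
    linarith [ciInf_le hg i, (abs_sub_le_iff.1 (h i)).2]

theorem two_pow_add_two_pow_le (φ ψ : RFormula) :
    (2 : ℝ) ^ φ.toCode + 2 ^ ψ.toCode ≤ 2 ^ (monus φ ψ).toCode := by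
  have h := Nat.add_le_pair φ.toCode ψ.toCode
  have h₁ : (2 : ℝ) ^ φ.toCode ≤ 2 ^ (φ.toCode + ψ.toCode) :=
    pow_le_pow_right₀ one_le_two (by omega)
  have h₂ : (2 : ℝ) ^ ψ.toCode ≤ 2 ^ (φ.toCode + ψ.toCode) :=
    pow_le_pow_right₀ one_le_two (by omega)
  have h₃ : (2 : ℝ) ^ (φ.toCode + ψ.toCode + 1) ≤ 2 ^ (monus φ ψ).toCode :=
    pow_le_pow_right₀ one_le_two (by rw [toCode]; omega)
  rw [pow_succ] at h₃
  linarith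

theorem toCode_lt_qinf (n : ℕ) (φ : RFormula) : φ.toCode < (qinf n φ).toCode := by
  have := Nat.right_le_pair n φ.toCode
  rw [toCode]
  omega

theorem toCode_lt_qsup (n : ℕ) (φ : RFormula) : φ.toCode < (qsup n φ).toCode := by
  have := Nat.right_le_pair n φ.toCode
  rw [toCode]
  omega

/-- In each variable a formula is Lipschitz, and its code bounds the Lipschitz constant. -/
theorem abs_eval_update_sub_le (φ : RFormula) (v : ℕ → A) (n : ℕ) (a b : A) :
    |φ.eval (update v n a) - φ.eval (update v n b)| ≤ 2 ^ φ.toCode * dist a b := by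
  have : Nonempty A := ⟨⊥⟩
  have hd : 0 ≤ dist a b := dist_nonneg
  have one_le : ∀ k : ℕ, (1 : ℝ) ≤ 2 ^ k := fun k => one_le_pow₀ one_le_two
  have term : ∀ (t : BTerm) (v : ℕ → A),
      dist (t.eval (update v n a)) (t.eval (update v n b)) ≤ dist a b :=
    fun t v => by
      rw [dist_eq_μ, dist_eq_μ]
      exact μ_mono (symmDiff_eval_update_le t v n a b)
  have meas : ∀ (t : BTerm) (v : ℕ → A),
      |μ (t.eval (update v n a)) - μ (t.eval (update v n b))| ≤ dist a b :=
    fun t v => (abs_μ_sub_le _ _).trans (term t v)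
  have pow_mono : ∀ {k l : ℕ}, k ≤ l → (2 : ℝ) ^ k * dist a b ≤ 2 ^ l * dist a b := fun h =>
    mul_le_mul_of_nonneg_right (pow_le_pow_right₀ one_le_two h) hd
  induction φ generalizing v with
  | meas t => exact (meas t v).trans (le_mul_of_one_le_left hd (one_le _))
  | metric s t =>
    rw [eval, eval, dist_eq_μ, dist_eq_μ, ← eval_symm, ← eval_symm]
    exact (meas _ v).trans (le_mul_of_one_le_left hd (one_le _))
  | zero | one =>
    rw [eval, eval, sub_self, abs_zero]
    positivity
  | half φ ih =>
    rw [eval, eval, ← sub_div, abs_div, abs_two]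
    have h₁ := ih v
    have h₂ : (2 : ℝ) ^ φ.toCode * dist a b ≤ 2 ^ (half φ).toCode * dist a b :=
      pow_mono (by rw [toCode]; omega)
    have h₃ := abs_nonneg (φ.eval (update v n a) - φ.eval (update v n b))
    linarith
  | monus φ ψ ih₁ ih₂ =>
    refine (abs_max_sub_max_le (ih₁ v) (ih₂ v)).trans ?_
    rw [← add_mul]
    exact mul_le_mul_of_nonneg_right (two_pow_add_two_pow_le φ ψ) hd
  | qinf k φ ih =>
    by_cases hk : k = n
    · subst hk
      simp only [eval, update_idem, sub_self, abs_zero]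
      positivity
    · refine (abs_iInf_sub_iInf_le (bddBelow_range_eval _ _ _) (bddBelow_range_eval _ _ _)
        fun c => ?_).trans (pow_mono (k := φ.toCode) ?_)
      · rw [update_comm (Ne.symm hk), update_comm (Ne.symm hk)]
        exact ih _
      · exact (toCode_lt_qinf k φ).le
  | qsup k φ ih =>
    rw [eval_qsup, eval_qsup, sub_sub_sub_cancel_left, abs_sub_comm]
    by_cases hk : k = n
    · subst hk
      simp only [eval, update_idem, sub_self, abs_zero]
      positivity
    · refine (abs_iInf_sub_iInf_le (bddBelow_range_eval _ _ _) (bddBelow_range_eval _ _ _)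
        fun c => ?_).trans (pow_mono (k := φ.toCode) ?_)
      · rw [update_comm (Ne.symm hk), update_comm (Ne.symm hk), eval_compl, eval_compl,
          sub_sub_sub_cancel_left, abs_sub_comm]
        exact ih _
      · exact (toCode_lt_qsup k φ).le

end Basic

variable [AtomlessProbabilityAlgebra A]

/-- Substituting a term in the coins and then averaging the coins out computes the value at the
element that the term defines from any actual coins. -/
theorem eval_averageCoins_subst {φ : RFormula} (hφ : φ.QuantifierFree) {m n : ℕ} {t : BTerm}
    (ht : t ∈ shannon
      (coinVars (φ.varList.sum + n + 1) (φ.varList.filter (· ≠ n)) m)) {v w : ℕ → A}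
    (hw : CoinTower (φ.varList.sum + n + 1) (φ.varList.filter (· ≠ n)) v m w) :
    ((φ.subst n t).averageCoins (φ.varList.sum + n + 1) m).eval v =
      φ.eval (update v n (t.eval w)) := by
  have hlt : ∀ k ∈ φ.freeVars, k < φ.varList.sum + n + 1 := fun k hk => by
    have := List.le_sum_of_mem ((mem_varList hφ).2 hk)
    omega
  rw [eval_averageCoins (.subst _ _ _) ?_ hw, eval_subst hφ]
  · refine eval_congr fun k hk => ?_
    by_cases hkn : k = n
    · subst hkn
      rw [update_self, update_self]
    · rw [update_of_ne hkn, update_of_ne hkn, hw.eq_of_lt (hlt k hk)]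
  · intro k hk
    rcases freeVars_subst hk with h | h
    · exact mem_coinVars.2 (Or.inl (List.mem_filter.2
        ⟨(mem_varList hφ).2 h.1, by simpa using h.2⟩))
    · exact vars_of_mem_shannon ht k h

/-- If `ψ` approximates `φ`, then `elimInf m n ψ` approximates `inf_n φ`. The Lipschitz constant
is that of `φ`, so that it does not depend on the precision `m` used to compute `ψ`. -/
theorem abs_qinf_sub_elimInf_le {φ ψ : RFormula} (hψ : ψ.QuantifierFree) {n : ℕ} (m : ℕ)
    {v : ℕ → A} {δ L : ℝ} (hL : 0 ≤ L)
    (hδ : ∀ a, |φ.eval (update v n a) - ψ.eval (update v n a)| ≤ δ)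
    (hlip : ∀ a b, |φ.eval (update v n a) - φ.eval (update v n b)| ≤ L * dist a b) :
    |(qinf n φ).eval v - (ψ.elimInf m n).eval v| ≤ δ + L * (1 / 2) ^ m := by
  have : Nonempty A := ⟨⊥⟩
  have hδ₀ : 0 ≤ δ := (abs_nonneg _).trans (hδ ⊥)
  have hε : 0 ≤ L * (1 / 2) ^ m := by positivity
  have hN : ∀ i ∈ ψ.varList.filter (· ≠ n), i < ψ.varList.sum + n + 1 := fun i hi => by
    have := List.le_sum_of_mem (List.mem_filter.1 hi).1
    omega
  rw [abs_sub_le_iff]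
  constructor
  · rw [sub_le_comm]
    refine le_eval_listMin ?_ fun χ hχ => ?_
    · linarith [(qinf n φ).eval_le_one v]
    · obtain ⟨t, ht, rfl⟩ := List.mem_map.1 hχ
      -- any coins will do here; those adapted to `⊥` are as good as others
      obtain ⟨w, hw, -⟩ := exists_coinTower _ hN v ⊥ m
      rw [eval_averageCoins_subst hψ ht hw]
      have h := ciInf_le (bddBelow_range_eval φ v n) (t.eval w)
      rw [← eval] at h
      linarith [(abs_sub_le_iff.1 (hδ (t.eval w))).1]
  · rw [sub_le_comm, eval]
    refine le_ciInf fun x => ?_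
    obtain ⟨w, hw, a, ⟨t, ht, rfl⟩, b, -, hax, hxb, hab⟩ := exists_coinTower _ hN v x m
    have hle := eval_listMin_le (List.mem_map_of_mem (f := fun t =>
      (ψ.subst n t).averageCoins (ψ.varList.sum + n + 1) m) ht) v
    rw [eval_averageCoins_subst hψ ht hw] at hle
    have hdist : L * dist (t.eval w) x ≤ L * (1 / 2) ^ m := by
      refine mul_le_mul_of_nonneg_left ?_ hL
      rw [dist_of_le hax]
      linarith [μ_mono hxb]
    have h₁ := (abs_sub_le_iff.1 (hδ (t.eval w))).2
    have h₂ := (abs_sub_le_iff.1 (hlip (t.eval w) x)).1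
    rw [elimInf]
    linarith

/-- The error of quantifier elimination with precision `m` is at most `2 ^ (code of φ) / 2 ^ m`. -/
theorem abs_eval_sub_eval_elim_le (m : ℕ) (φ : RFormula) (v : ℕ → A) :
    |φ.eval v - (φ.elim m).eval v| ≤ 2 ^ φ.toCode * (1 / 2) ^ m := by
  have hm : (0 : ℝ) ≤ (1 / 2) ^ m := by positivity
  have quantifier : ∀ {k l : ℕ}, k < l →
      (2 : ℝ) ^ k * (1 / 2) ^ m + 2 ^ k * (1 / 2) ^ m ≤ 2 ^ l * (1 / 2) ^ m := fun {k l} h => by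
    have : (2 : ℝ) ^ (k + 1) ≤ 2 ^ l := pow_le_pow_right₀ one_le_two h
    rw [← add_mul]
    refine mul_le_mul_of_nonneg_right ?_ hm
    rw [pow_succ] at this
    linarith
  induction φ generalizing v with
  | meas | metric | zero | one =>
    rw [elim]
    simp only [eval, sub_self, abs_zero]
    positivity
  | half φ ih =>
    rw [elim, eval, eval, ← sub_div, abs_div, abs_two]
    have h₁ := ih v
    have h₂ : (2 : ℝ) ^ φ.toCode * (1 / 2) ^ m ≤ 2 ^ (half φ).toCode * (1 / 2) ^ m :=
      mul_le_mul_of_nonneg_right (pow_le_pow_right₀ one_le_two (by rw [toCode]; omega)) hm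
    have h₃ := abs_nonneg (φ.eval v - (φ.elim m).eval v)
    linarith
  | monus φ ψ ih₁ ih₂ =>
    refine (abs_max_sub_max_le (ih₁ v) (ih₂ v)).trans ?_
    rw [← add_mul]
    exact mul_le_mul_of_nonneg_right (two_pow_add_two_pow_le φ ψ) hm
  | qinf n φ ih =>
    exact (abs_qinf_sub_elimInf_le (quantifierFree_elim m φ) m (by positivity) (fun a => ih _)
      (φ.abs_eval_update_sub_le v n)).trans (quantifier (toCode_lt_qinf n φ))
  | qsup n φ ih =>
    have hq : (φ.elim m).compl.QuantifierFree := ⟨trivial, quantifierFree_elim m φ⟩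
    rw [elim, eval_qsup, eval_compl, sub_sub_sub_cancel_left, abs_sub_comm]
    refine (abs_qinf_sub_elimInf_le (δ := 2 ^ φ.toCode * (1 / 2) ^ m) (L := 2 ^ φ.toCode)
      hq m (by positivity) (fun a => ?_)
      fun a b => ?_).trans (quantifier (toCode_lt_qsup n φ))
    · rw [eval_compl, eval_compl, sub_sub_sub_cancel_left, abs_sub_comm]
      exact ih _
    · rw [eval_compl, eval_compl, sub_sub_sub_cancel_left, abs_sub_comm]
      exact φ.abs_eval_update_sub_le v n a b

end Eval
end RFormula
end PrA

namespace PrA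

open BTerm RFormula

/-! ### Structural recursion is primitive recursive -/

section Computability

theorem getD_map_range {σ : Type*} (f : ℕ → σ) {n k : ℕ} (h : k < n) (d : σ) :
    ((List.range n).map f).getD k d = f k := by
  simp [List.getD, h]

section Terms

variable {α σ : Type*} [Primcodable α] [Primcodable σ] [Inhabited σ]

/-- A function defined by structural recursion on terms from primitive recursive data is primitive
recursive. -/
theorem primrec_of_term_rec {F : α → BTerm → σ} {gv : α → ℕ → σ} {gb gt : α → σ}
    {gc : α → σ → σ} {gi gu : α → σ × σ → σ} (hv : Primrec₂ gv) (hb : Primrec gb)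
    (ht : Primrec gt) (hc : Primrec₂ gc) (hi : Primrec₂ gi) (hu : Primrec₂ gu)
    (ev : ∀ a n, F a (.var n) = gv a n) (eb : ∀ a, F a .bot = gb a) (et : ∀ a, F a .top = gt a)
    (ec : ∀ a t, F a (.compl t) = gc a (F a t))
    (ei : ∀ a s t, F a (.inter s t) = gi a (F a s, F a t))
    (eu : ∀ a s t, F a (.union s t) = gu a (F a s, F a t)) : Primrec₂ F := by
  -- the values at smaller codes form a list whose length is the present code; the code `n ≥ 2` of a
  -- term names its constructor by `(n - 2) % 4` and its components by `(n - 2) / 4`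
  let k : α × List σ → ℕ := fun p => (p.2.length - 2) / 4
  let r : α × List σ → ℕ := fun p => (p.2.length - 2) % 4
  let x : ℕ → α × List σ → σ := fun i p => p.2.getD i default
  let xx : α × List σ → σ × σ := fun p => (x (k p).unpair.1 p, x (k p).unpair.2 p)
  let g : α → List σ → Option σ := fun a l => some <|
    if l.length = 0 then gb a else if l.length = 1 then gt a
    else if r (a, l) = 0 then gv a (k (a, l))
    else if r (a, l) = 1 then gc a (x (k (a, l)) (a, l))
    else if r (a, l) = 2 then gi a (xx (a, l)) else gu a (xx (a, l))
  have len : Primrec fun p : α × List σ => p.2.length := Primrec.list_length.comp Primrec.snd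
  have len2 : Primrec fun p : α × List σ => p.2.length - 2 :=
    Primrec.nat_sub.comp len (Primrec.const 2)
  have hk : Primrec k := Primrec.nat_div.comp len2 (Primrec.const 4)
  have hr : Primrec r := Primrec.nat_mod.comp len2 (Primrec.const 4)
  have hx : ∀ {i : α × List σ → ℕ}, Primrec i → Primrec fun p => x (i p) p := fun h =>
    (Primrec.list_getD default).comp Primrec.snd h
  have hku := Primrec.unpair.comp hk
  have hxx : Primrec xx := (hx (Primrec.fst.comp hku)).pair (hx (Primrec.snd.comp hku))
  have is : ∀ {i : α × List σ → ℕ}, Primrec i → ∀ c, PrimrecPred fun p => i p = c := fun h c =>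
    Primrec.eq.comp h (Primrec.const c)
  have hg : Primrec₂ g := by
    refine Primrec.option_some.comp ?_
    exact .ite (is len 0) (hb.comp .fst) <| .ite (is len 1) (ht.comp .fst) <|
      .ite (is hr 0) (hv.comp .fst hk) <| .ite (is hr 1) (hc.comp .fst (hx hk)) <|
      .ite (is hr 2) (hi.comp .fst hxx) (hu.comp .fst hxx)
  have main : Primrec₂ fun a n => F a (Denumerable.ofNat BTerm n) := by
    refine Primrec.nat_strong_rec _ hg fun a n => ?_
    obtain ⟨t, rfl⟩ : ∃ t : BTerm, n = Encodable.encode t :=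
      ⟨Denumerable.ofNat BTerm n, (Denumerable.encode_ofNat n).symm⟩
    rw [Denumerable.ofNat_encode]
    have get : ∀ s : BTerm, s.toCode < t.toCode →
        x s.toCode (a, (List.range t.toCode).map fun n => F a (Denumerable.ofNat BTerm n)) =
          F a s := fun s hs => by
      have e : Denumerable.ofNat BTerm s.toCode = s := Denumerable.ofNat_encode s
      simp only [x]
      rw [getD_map_range _ hs, e]
    change some _ = some _
    congr 1
    change (if _ then _ else _) = _
    simp only [List.length_map, List.length_range, k, r, xx]
    change (if t.toCode = 0 then _ else _) = _
    have ek : Encodable.encode t = t.toCode := rfl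
    rw [ek]
    cases t with
    | bot => rw [BTerm.toCode, if_pos rfl, eb]
    | top => rw [BTerm.toCode, if_neg one_ne_zero, if_pos rfl, et]
    | var n =>
      have h₁ : (BTerm.var n).toCode - 2 = 4 * n := by rw [BTerm.toCode]; omega
      rw [h₁, if_neg (by rw [BTerm.toCode]; omega), if_neg (by rw [BTerm.toCode]; omega),
        if_pos (by omega), show 4 * n / 4 = n by omega, ev]
    | compl s =>
      have h₁ : s.compl.toCode - 2 = 4 * s.toCode + 1 := by rw [BTerm.toCode]; omega
      rw [h₁, if_neg (by rw [BTerm.toCode]; omega), if_neg (by rw [BTerm.toCode]; omega),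
        if_neg (by omega), if_pos (by omega), show (4 * s.toCode + 1) / 4 = s.toCode by omega,
        get s (by rw [BTerm.toCode]; omega), ec]
    | inter s t =>
      have l₁ := Nat.left_le_pair s.toCode t.toCode
      have l₂ := Nat.right_le_pair s.toCode t.toCode
      have h₁ : (s.inter t).toCode - 2 = 4 * Nat.pair s.toCode t.toCode + 2 := by
        rw [BTerm.toCode]; omega
      rw [h₁, if_neg (by rw [BTerm.toCode]; omega), if_neg (by rw [BTerm.toCode]; omega),
        if_neg (by omega), if_neg (by omega), if_pos (by omega),
        show ∀ n, (4 * n + 2) / 4 = n by omega, Nat.unpair_pair,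
        get s (by rw [BTerm.toCode]; omega), get t (by rw [BTerm.toCode]; omega), ei]
    | union s t =>
      have l₁ := Nat.left_le_pair s.toCode t.toCode
      have l₂ := Nat.right_le_pair s.toCode t.toCode
      have h₁ : (s.union t).toCode - 2 = 4 * Nat.pair s.toCode t.toCode + 3 := by
        rw [BTerm.toCode]; omega
      rw [h₁, if_neg (by rw [BTerm.toCode]; omega), if_neg (by rw [BTerm.toCode]; omega),
        if_neg (by omega), if_neg (by omega), if_neg (by omega),
        show ∀ n, (4 * n + 3) / 4 = n by omega, Nat.unpair_pair,
        get s (by rw [BTerm.toCode]; omega), get t (by rw [BTerm.toCode]; omega), eu]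
  exact (main.comp .fst (Primrec.encode.comp .snd)).of_eq fun p => by
    rw [Denumerable.ofNat_encode]

/-- A function defined by structural recursion on formulas from primitive recursive data is
primitive recursive. -/
theorem primrec_of_formula_rec {F : α → RFormula → σ} {gm : α → BTerm → σ}
    {gd : α → BTerm × BTerm → σ} {gz go gh : α → σ → σ} {gs : α → σ × σ → σ}
    {gi gu : α → ℕ × σ → σ} (hm : Primrec₂ gm) (hd : Primrec₂ gd) (hz : Primrec₂ gz)
    (ho : Primrec₂ go) (hh : Primrec₂ gh) (hs : Primrec₂ gs) (hi : Primrec₂ gi) (hu : Primrec₂ gu)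
    (em : ∀ a t, F a (.meas t) = gm a t) (ed : ∀ a s t, F a (.metric s t) = gd a (s, t))
    (ez : ∀ a φ, F a (.zero φ) = gz a (F a φ)) (eo : ∀ a φ, F a (.one φ) = go a (F a φ))
    (eh : ∀ a φ, F a (.half φ) = gh a (F a φ))
    (es : ∀ a φ ψ, F a (.monus φ ψ) = gs a (F a φ, F a ψ))
    (ei : ∀ a n φ, F a (.qinf n φ) = gi a (n, F a φ))
    (eu : ∀ a n φ, F a (.qsup n φ) = gu a (n, F a φ)) : Primrec₂ F := by
  -- as for terms, the length of the list of previous values is the present code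
  let k : α × List σ → ℕ := fun p => p.2.length / 8
  let r : α × List σ → ℕ := fun p => p.2.length % 8
  let x : ℕ → α × List σ → σ := fun i p => p.2.getD i default
  let g : α → List σ → Option σ := fun a l => some <|
    if r (a, l) = 0 then gm a (Denumerable.ofNat BTerm (k (a, l)))
    else if r (a, l) = 1 then gd a (Denumerable.ofNat BTerm (k (a, l)).unpair.1,
      Denumerable.ofNat BTerm (k (a, l)).unpair.2)
    else if r (a, l) = 2 then gz a (x (k (a, l)) (a, l))
    else if r (a, l) = 3 then go a (x (k (a, l)) (a, l))
    else if r (a, l) = 4 then gh a (x (k (a, l)) (a, l))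
    else if r (a, l) = 5 then gs a (x (k (a, l)).unpair.1 (a, l), x (k (a, l)).unpair.2 (a, l))
    else if r (a, l) = 6 then gi a ((k (a, l)).unpair.1, x (k (a, l)).unpair.2 (a, l))
    else gu a ((k (a, l)).unpair.1, x (k (a, l)).unpair.2 (a, l))
  have len : Primrec fun p : α × List σ => p.2.length := Primrec.list_length.comp Primrec.snd
  have hk : Primrec k := Primrec.nat_div.comp len (Primrec.const 8)
  have hr : Primrec r := Primrec.nat_mod.comp len (Primrec.const 8)
  have hx : ∀ {i : α × List σ → ℕ}, Primrec i → Primrec fun p => x (i p) p := fun h =>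
    (Primrec.list_getD default).comp Primrec.snd h
  have hk₁ := Primrec.fst.comp (Primrec.unpair.comp hk)
  have hk₂ := Primrec.snd.comp (Primrec.unpair.comp hk)
  have hn := Primrec.ofNat BTerm
  have is : ∀ c, PrimrecPred fun p => r p = c := fun c => Primrec.eq.comp hr (Primrec.const c)
  have hg : Primrec₂ g := by
    refine Primrec.option_some.comp ?_
    exact .ite (is 0) (hm.comp .fst (hn.comp hk)) <|
      .ite (is 1) (hd.comp .fst ((hn.comp hk₁).pair (hn.comp hk₂))) <|
      .ite (is 2) (hz.comp .fst (hx hk)) <| .ite (is 3) (ho.comp .fst (hx hk)) <|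
      .ite (is 4) (hh.comp .fst (hx hk)) <| .ite (is 5) (hs.comp .fst ((hx hk₁).pair (hx hk₂))) <|
      .ite (is 6) (hi.comp .fst (hk₁.pair (hx hk₂))) (hu.comp .fst (hk₁.pair (hx hk₂)))
  have main : Primrec₂ fun a n => F a (Denumerable.ofNat RFormula n) := by
    refine Primrec.nat_strong_rec _ hg fun a n => ?_
    obtain ⟨φ, rfl⟩ : ∃ φ : RFormula, n = Encodable.encode φ :=
      ⟨Denumerable.ofNat RFormula n, (Denumerable.encode_ofNat n).symm⟩
    rw [Denumerable.ofNat_encode]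
    have get : ∀ ψ : RFormula, ψ.toCode < φ.toCode →
        x ψ.toCode (a, (List.range φ.toCode).map fun n => F a (Denumerable.ofNat RFormula n)) =
          F a ψ := fun ψ hψ => by
      have e : Denumerable.ofNat RFormula ψ.toCode = ψ := Denumerable.ofNat_encode ψ
      simp only [x]
      rw [getD_map_range _ hψ, e]
    have ek : Encodable.encode φ = φ.toCode := rfl
    change some (if _ then _ else _) = some _
    congr 1
    simp only [List.length_map, List.length_range, k, r]
    rw [ek]
    have key : ∀ m i : ℕ, i < 8 → (8 * m + i) % 8 = i ∧ (8 * m + i) / 8 = m := by omega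
    -- the code of a formula is `8 * m + i`, where `i` numbers the constructor
    have reduce : ∀ m i : ℕ, i < 8 → φ.toCode = 8 * m + i →
        φ.toCode % 8 = i ∧ φ.toCode / 8 = m := fun m i hi h => by rw [h]; exact key m i hi
    cases φ with
    | meas t =>
      obtain ⟨h₁, h₂⟩ := reduce _ 0 (by norm_num) rfl
      simp only [h₁, h₂]
      simp [em]
    | metric s t =>
      obtain ⟨h₁, h₂⟩ := reduce _ 1 (by norm_num) rfl
      simp only [h₁, h₂]
      simp [ed]
    | zero φ =>
      obtain ⟨h₁, h₂⟩ := reduce _ 2 (by norm_num) rfl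
      simp only [h₁, h₂]
      rw [get φ (by rw [RFormula.toCode]; omega), ez]
      simp
    | one φ =>
      obtain ⟨h₁, h₂⟩ := reduce _ 3 (by norm_num) rfl
      simp only [h₁, h₂]
      rw [get φ (by rw [RFormula.toCode]; omega), eo]
      simp
    | half φ =>
      obtain ⟨h₁, h₂⟩ := reduce _ 4 (by norm_num) rfl
      simp only [h₁, h₂]
      rw [get φ (by rw [RFormula.toCode]; omega), eh]
      simp
    | monus φ ψ =>
      obtain ⟨h₁, h₂⟩ := reduce _ 5 (by norm_num) rfl
      have l₁ := Nat.left_le_pair φ.toCode ψ.toCode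
      have l₂ := Nat.right_le_pair φ.toCode ψ.toCode
      simp only [h₁, h₂, Nat.unpair_pair]
      rw [get φ (by rw [RFormula.toCode]; omega), get ψ (by rw [RFormula.toCode]; omega), es]
      simp
    | qinf n φ =>
      obtain ⟨h₁, h₂⟩ := reduce _ 6 (by norm_num) rfl
      simp only [h₁, h₂, Nat.unpair_pair]
      rw [get φ (toCode_lt_qinf n φ), ei]
      simp
    | qsup n φ =>
      obtain ⟨h₁, h₂⟩ := reduce _ 7 (by norm_num) rfl
      simp only [h₁, h₂, Nat.unpair_pair]
      rw [get φ (toCode_lt_qsup n φ), eu]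
      simp
  exact (main.comp .fst (Primrec.encode.comp .snd)).of_eq fun p => by
    rw [Denumerable.ofNat_encode]

end Terms

/-! ### The elimination procedure is primitive recursive -/

theorem primrec_mul_add {α : Type*} [Primcodable α] {f : α → ℕ} (c d : ℕ) (hf : Primrec f) :
    Primrec fun a => c * f a + d :=
  Primrec.nat_add.comp (Primrec.nat_mul.comp (Primrec.const c) hf) (Primrec.const d)

theorem primrec_var : Primrec BTerm.var :=
  Primrec.encode_iff.1 (primrec_mul_add 4 2 Primrec.id)

theorem primrec_compl : Primrec BTerm.compl :=
  Primrec.encode_iff.1 (primrec_mul_add 4 3 Primrec.encode)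

theorem primrec_natPair_encode {α β : Type*} [Primcodable α] [Primcodable β] :
    Primrec fun p : α × β => Nat.pair (Encodable.encode p.1) (Encodable.encode p.2) :=
  Primrec₂.natPair.comp (Primrec.encode.comp .fst) (Primrec.encode.comp .snd)

theorem primrec_inter : Primrec₂ BTerm.inter :=
  Primrec.encode_iff.1 (primrec_mul_add 4 4 primrec_natPair_encode)

theorem primrec_union : Primrec₂ BTerm.union :=
  Primrec.encode_iff.1 (primrec_mul_add 4 5 primrec_natPair_encode)

theorem primrec_meas : Primrec RFormula.meas :=
  Primrec.encode_iff.1 (primrec_mul_add 8 0 Primrec.encode)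

theorem primrec_metric : Primrec₂ RFormula.metric :=
  Primrec.encode_iff.1 (primrec_mul_add 8 1 primrec_natPair_encode)

theorem primrec_zero : Primrec RFormula.zero :=
  Primrec.encode_iff.1 (primrec_mul_add 8 2 Primrec.encode)

theorem primrec_one : Primrec RFormula.one :=
  Primrec.encode_iff.1 (primrec_mul_add 8 3 Primrec.encode)

theorem primrec_half : Primrec RFormula.half :=
  Primrec.encode_iff.1 (primrec_mul_add 8 4 Primrec.encode)

theorem primrec_monus : Primrec₂ RFormula.monus :=
  Primrec.encode_iff.1 (primrec_mul_add 8 5 primrec_natPair_encode)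

theorem primrec_term_subst : Primrec₂ fun (p : ℕ × BTerm) (s : BTerm) => s.subst p.1 p.2 := by
  have : Inhabited BTerm := ⟨bot⟩
  have hv : Primrec₂ fun (p : ℕ × BTerm) (k : ℕ) => if k = p.1 then p.2 else var k :=
    .ite (Primrec.eq.comp .snd (Primrec.fst.comp .fst)) (Primrec.snd.comp .fst)
      (primrec_var.comp .snd)
  exact primrec_of_term_rec
    (gb := fun _ => bot) (gt := fun _ => top) (gc := fun _ s => s.compl)
    (gi := fun _ q => q.1.inter q.2) (gu := fun _ q => q.1.union q.2) hv (.const _) (.const _)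
    (primrec_compl.comp .snd)
    (primrec_inter.comp (Primrec.fst.comp .snd) (Primrec.snd.comp .snd))
    (primrec_union.comp (Primrec.fst.comp .snd) (Primrec.snd.comp .snd))
    (fun _ _ => rfl) (fun _ => rfl) (fun _ => rfl) (fun _ _ => rfl) (fun _ _ _ => rfl)
    (fun _ _ _ => rfl)

theorem primrec_symm : Primrec₂ BTerm.symm :=
  primrec_union.comp (primrec_inter.comp .fst (primrec_compl.comp .snd))
    (primrec_inter.comp .snd (primrec_compl.comp .fst))

theorem primrec_term_varList : Primrec BTerm.varList := by
  have h : Primrec₂ fun (_ : Unit) (t : BTerm) => t.varList :=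
    primrec_of_term_rec (gv := fun _ k => [k])
      (gb := fun _ => []) (gt := fun _ => []) (gc := fun _ l => l)
      (gi := fun _ q => q.1 ++ q.2) (gu := fun _ q => q.1 ++ q.2)
      (Primrec.list_cons.comp .snd (.const [])) (.const _) (.const _) .snd
      (Primrec.list_append.comp (Primrec.fst.comp .snd) (Primrec.snd.comp .snd))
      (Primrec.list_append.comp (Primrec.fst.comp .snd) (Primrec.snd.comp .snd))
      (fun _ _ => rfl) (fun _ => rfl) (fun _ => rfl) (fun _ _ => rfl) (fun _ _ _ => rfl)
      (fun _ _ _ => rfl)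
  exact h.comp (.const ()) .id

theorem primrec_varList : Primrec RFormula.varList := by
  have h : Primrec₂ fun (_ : Unit) (φ : RFormula) => φ.varList :=
    primrec_of_formula_rec (gm := fun _ t => t.varList)
      (gd := fun _ q => q.1.varList ++ q.2.varList) (gz := fun _ l => l) (go := fun _ l => l)
      (gh := fun _ l => l) (gs := fun _ q => q.1 ++ q.2) (gi := fun _ q => q.2)
      (gu := fun _ q => q.2) (primrec_term_varList.comp .snd)
      (Primrec.list_append.comp (primrec_term_varList.comp (Primrec.fst.comp .snd))
        (primrec_term_varList.comp (Primrec.snd.comp .snd)))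
      .snd .snd .snd (Primrec.list_append.comp (Primrec.fst.comp .snd) (Primrec.snd.comp .snd))
      (Primrec.snd.comp .snd) (Primrec.snd.comp .snd)
      (fun _ _ => rfl) (fun _ _ _ => rfl) (fun _ _ => rfl) (fun _ _ => rfl) (fun _ _ => rfl)
      (fun _ _ _ => rfl) (fun _ _ _ => rfl) (fun _ _ _ => rfl)
  exact h.comp (.const ()) .id

theorem shannon_eq_foldr (l : List ℕ) :
    shannon l = l.foldr (fun n T => T.flatMap fun s => T.map fun t => cond (.var n) s t)
      [bot, top] := by
  induction l with
  | nil => rfl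
  | cons n l ih => rw [shannon, List.foldr_cons, ih]

theorem primrec_shannon : Primrec shannon := by
  have hc : Primrec fun p : ℕ × BTerm × BTerm => cond (.var p.1) p.2.1 p.2.2 :=
    primrec_union.comp
      (primrec_inter.comp (primrec_var.comp .fst) (Primrec.fst.comp .snd))
      (primrec_inter.comp (primrec_compl.comp (primrec_var.comp .fst)) (Primrec.snd.comp .snd))
  refine (Primrec.list_foldr (h := fun (_ : List ℕ) (p : ℕ × List BTerm) =>
    p.2.flatMap fun s => p.2.map fun t => cond (.var p.1) s t) .id (.const [bot, top]) ?_).of_eq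
    fun l => (shannon_eq_foldr l).symm
  refine Primrec.list_flatMap (Primrec.snd.comp .snd) ?_
  refine Primrec.list_map (Primrec.snd.comp (Primrec.snd.comp .fst)) ?_
  exact hc.comp ((Primrec.fst.comp (Primrec.snd.comp (Primrec.fst.comp .fst))).pair
    ((Primrec.snd.comp .fst).pair .snd))

theorem primrec_coinVars :
    Primrec fun p : ℕ × List ℕ × ℕ => coinVars p.1 p.2.1 p.2.2 := by
  have h : Primrec₂ fun (p : ℕ × List ℕ) (k : ℕ) => coinVars p.1 p.2 k := by
    refine (Primrec.nat_rec (f := fun p : ℕ × List ℕ => p.2)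
      (g := fun p q => (p.1 + q.1) :: q.2) .snd ?_).of_eq fun p k => ?_
    · exact Primrec.list_cons.comp (Primrec.nat_add.comp (Primrec.fst.comp .fst)
        (Primrec.fst.comp .snd)) (Primrec.snd.comp .snd)
    · induction k with
      | zero => rfl
      | succ k ih => rw [coinVars, ← ih]
  exact h.comp (Primrec.fst.pair (Primrec.fst.comp .snd)) (Primrec.snd.comp .snd)

theorem primrec_formula_compl : Primrec RFormula.compl :=
  primrec_monus.comp (.const _) .id

theorem primrec_plus : Primrec₂ RFormula.plus :=
  primrec_formula_compl.comp (primrec_monus.comp (primrec_formula_compl.comp .fst) .snd)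

theorem primrec_listMin : Primrec RFormula.listMin := by
  refine Primrec.list_foldr (h := fun (_ : List RFormula) (p : RFormula × RFormula) =>
    p.1.min p.2) .id (.const _) ?_
  have h₁ : Primrec fun q : List RFormula × RFormula × RFormula => q.2.1 := Primrec.fst.comp .snd
  exact primrec_monus.comp h₁ (primrec_monus.comp h₁ (Primrec.snd.comp .snd))

theorem primrec_mapMeas {α : Type*} [Primcodable α] {f : α → BTerm → RFormula}
    (hf : Primrec₂ f) : Primrec₂ fun a (φ : RFormula) => φ.mapMeas (f a) := by
  have : Inhabited RFormula := ⟨.meas bot⟩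
  exact primrec_of_formula_rec (gm := f) (gd := fun a q => f a (q.1.symm q.2))
    (gz := fun a _ => f a bot) (go := fun a _ => f a top) (gh := fun _ φ => φ.half)
    (gs := fun _ q => q.1.monus q.2) (gi := fun a _ => f a bot) (gu := fun a _ => f a bot) hf
    (hf.comp .fst (primrec_symm.comp (Primrec.fst.comp .snd) (Primrec.snd.comp .snd)))
    (hf.comp .fst (.const bot)) (hf.comp .fst (.const top)) (primrec_half.comp .snd)
    (primrec_monus.comp (Primrec.fst.comp .snd) (Primrec.snd.comp .snd))
    (hf.comp .fst (.const bot)) (hf.comp .fst (.const bot))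
    (fun _ _ => rfl) (fun _ _ _ => rfl) (fun _ _ => rfl) (fun _ _ => rfl) (fun _ _ => rfl)
    (fun _ _ _ => rfl) (fun _ _ _ => rfl) (fun _ _ _ => rfl)

theorem primrec_subst :
    Primrec₂ fun (p : ℕ × BTerm) (φ : RFormula) => φ.subst p.1 p.2 :=
  primrec_mapMeas (primrec_meas.comp primrec_term_subst)

theorem primrec_average : Primrec₂ RFormula.average := by
  have h : ∀ c : BTerm, Primrec fun p : ℕ × BTerm =>
      RFormula.half (.meas (p.2.subst p.1 c)) := fun c =>
    primrec_half.comp (primrec_meas.comp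
      (primrec_term_subst.comp (Primrec.fst.pair (.const c)) .snd))
  exact primrec_mapMeas (primrec_plus.comp (h bot) (h top))

theorem primrec_averageCoins :
    Primrec fun p : ℕ × ℕ × RFormula => p.2.2.averageCoins p.1 p.2.1 :=
  Primrec.list_foldr
    (h := fun (p : ℕ × ℕ × RFormula) (q : ℕ × RFormula) => q.2.average (p.1 + q.1))
    (Primrec.list_range.comp (Primrec.fst.comp .snd)) (Primrec.snd.comp .snd)
    (primrec_average.comp
      (Primrec.nat_add.comp (Primrec.fst.comp .fst) (Primrec.fst.comp .snd))
      (Primrec.snd.comp .snd))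

theorem primrec_elimInf : Primrec fun p : ℕ × ℕ × RFormula => p.2.2.elimInf p.1 p.2.1 := by
  have hm : Primrec fun p : ℕ × ℕ × RFormula => p.1 := .fst
  have hn : Primrec fun p : ℕ × ℕ × RFormula => p.2.1 := Primrec.fst.comp .snd
  have hφ : Primrec fun p : ℕ × ℕ × RFormula => p.2.2 := Primrec.snd.comp .snd
  have hl := primrec_varList.comp hφ
  have hsum : Primrec (List.sum : List ℕ → ℕ) :=
    Primrec.list_foldr (h := fun (_ : List ℕ) (p : ℕ × ℕ) => p.1 + p.2) .id (.const 0)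
      (Primrec.nat_add.comp (Primrec.fst.comp .snd) (Primrec.snd.comp .snd))
  have hN : Primrec fun p : ℕ × ℕ × RFormula => p.2.2.varList.sum + p.2.1 + 1 :=
    Primrec.succ.comp (Primrec.nat_add.comp (hsum.comp hl) hn)
  have hys : Primrec fun p : ℕ × ℕ × RFormula => p.2.2.varList.filter (· ≠ p.2.1) :=
    (PrimrecRel.listFilter (R := fun k n : ℕ => k ≠ n) Primrec.eq.not).comp hl hn
  refine primrec_listMin.comp (Primrec.list_map
    (primrec_shannon.comp (primrec_coinVars.comp (hN.pair (hys.pair hm)))) ?_)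
  exact primrec_averageCoins.comp ((hN.comp .fst).pair ((hm.comp .fst).pair
    (primrec_subst.comp ((hn.comp .fst).pair .snd) (hφ.comp .fst))))

theorem primrec_elim : Primrec₂ RFormula.elim := by
  have : Inhabited RFormula := ⟨.meas bot⟩
  have hn : Primrec fun p : ℕ × ℕ × RFormula => p.2.1 := Primrec.fst.comp .snd
  have hφ : Primrec fun p : ℕ × ℕ × RFormula => p.2.2 := Primrec.snd.comp .snd
  exact primrec_of_formula_rec (gm := fun _ t => .meas t) (gd := fun _ q => .metric q.1 q.2)
    (gz := fun _ φ => φ.zero) (go := fun _ φ => φ.one) (gh := fun _ φ => φ.half)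
    (gs := fun _ q => q.1.monus q.2) (gi := fun m q => q.2.elimInf m q.1)
    (gu := fun m q => (q.2.compl.elimInf m q.1).compl)
    (primrec_meas.comp .snd)
    (primrec_metric.comp (Primrec.fst.comp .snd) (Primrec.snd.comp .snd))
    (primrec_zero.comp .snd) (primrec_one.comp .snd) (primrec_half.comp .snd)
    (primrec_monus.comp (Primrec.fst.comp .snd) (Primrec.snd.comp .snd))
    primrec_elimInf
    (primrec_formula_compl.comp (primrec_elimInf.comp
      (Primrec.fst.pair (hn.pair (primrec_formula_compl.comp hφ)))))
    (fun _ _ => rfl) (fun _ _ _ => rfl) (fun _ _ => rfl) (fun _ _ => rfl) (fun _ _ => rfl)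
    (fun _ _ _ => rfl) (fun _ _ _ => rfl) (fun _ _ _ => rfl)
end Computability
end PrA

theorem mainTheorem5 :
    ∃ F : PrA.RFormula × ℕ × ℕ → PrA.RFormula, Computable F ∧
      ∀ (φ : PrA.RFormula) (ε : ℚ), 0 < ε →
        (F (φ, ε.num.toNat, ε.den)).QuantifierFree ∧
        (F (φ, ε.num.toNat, ε.den)).freeVars ⊆ φ.freeVars ∧
        PrA.theoryDist.{u} φ (F (φ, ε.num.toNat, ε.den)) < (ε : ℝ) := by
  refine ⟨fun p => p.1.elim (p.1.toCode + p.2.2), ?_, fun φ ε hε =>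
    ⟨PrA.RFormula.quantifierFree_elim _ _, PrA.RFormula.freeVars_elim _ _, ?_⟩⟩
  · refine (PrA.primrec_elim.comp ?_ Primrec.fst).to_comp
    exact Primrec.nat_add.comp (Primrec.encode.comp Primrec.fst) (Primrec.snd.comp Primrec.snd)
  · have hden : (0 : ℝ) < ε.den := by exact_mod_cast ε.den_pos
    -- the error bound `2 ^ (code of φ) / 2 ^ m` is `2⁻ᵈ`, where `d` is the denominator of `ε`
    have hdist : PrA.theoryDist.{u} φ (φ.elim (φ.toCode + ε.den)) ≤ (1 / 2) ^ ε.den := by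
      refine Real.sSup_le ?_ (by positivity)
      rintro _ ⟨A, _, v, rfl⟩
      refine (PrA.RFormula.abs_eval_sub_eval_elim_le _ φ v).trans_eq ?_
      rw [pow_add, ← mul_assoc, ← mul_pow]
      norm_num
    have hlt : ((1 : ℝ) / 2) ^ ε.den < 1 / ε.den := by
      rw [one_div_pow]
      exact one_div_lt_one_div_of_lt hden (by exact_mod_cast Nat.lt_two_pow_self)
    have hnum : (1 : ℝ) / ε.den ≤ ε := by
      have h : (1 : ℝ) ≤ ε.num := by exact_mod_cast Rat.num_pos.2 hε
      rw [Rat.cast_def]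
      exact div_le_div_of_nonneg_right h hden.le
    exact hdist.trans_lt (hlt.trans_le hnum)
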